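/- Let $k,T\ge 1$, and let $k$ subsystems with $\mathbb R^n$-valued states $x^i_t$ and $\mathbb R^m$-valued controls $u^i_t$ obey $$x^i_{t+1}=A_tx^i_t+B_tu^i_t+C_t\bar x_t+w^i_{t+1},\qquad 1\le i\le k,\ 0\le t<T,$$ where $\bar x_t=\frac1k\sum_{j=1}^k x^j_t$ is the mean-field and $A_t,C_t\in\mathbb R^{n\times n}$, $B_t\in\mathbb R^{n\times m}$. Write $\mathbf x_t=(x^1_t,\dots,x^k_t)$, and similarly $\mathbf u_t$, $\mathbf w_t$. Assume that $\mathbf x_0$ is deterministic, that $\mathbf w_1,\dots,\mathbf w_T$ are i.i.d., that $w^1_t,\dots,w^k_t$ are i.i.d. for each $t$, and that $\mathbb E\|w^i_t\|^4<\infty$. Let $\mathcal F_t=\sigma(\mathbf x_0,\dots,\mathbf x_t,\mathbf u_0,\dots,\mathbf u_{t-1})$, with $\mathcal F_{-1}$ trivial. A control $\mathbf u=(\mathbf u_0,\dots,\mathbf u_{T-1})$ is admissible if every $u^i_t$ is $\mathcal F_t$-measurable with $\mathbb E\|u^i_t\|^2<\infty$. Let $P_t,Q_t$ ($0\le t\le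 T$) be symmetric positive semidefinite, $R_t$ ($0\le t<T$) symmetric positive definite, $\lambda\ge 0$, and put $$\Delta^i_t={x^i_t}^\top Q_tx^i_t-\mathbb E\big({x^i_t}^\top Q_tx^i_t\,\big|\,\mathcal F_{t-1}\big),$$ $$J(\mathbf u)=\sum_{t=0}^{T}\sum_{i=1}^k\Big(\bar x_t^\top P_t\bar x_t+{x^i_t}^\top Q_tx^i_t+\lambda(\Delta^i_t)^2\Big)+\sum_{t=0}^{T-1}\sum_{i=1}^k{u^i_t}^\top R_tu^i_t .$$ Let $\mu=\mathbb E(w^i_t)$, $d=w^i_t-\mu$, $\Sigma=\mathbb E(dd^\top)$, $\gamma_t=\mathbb E(dd^\top Q_td)$, $Q^\lambda_t=4\lambda Q_t\Sigma Q_t$, $b^\lambda_t=4\lambda Q_t\gamma_t$, $\bar A_t=A_t+C_t$ and $\bar Q_t=P_t+Q_t$. Define backwards $S_T=Q_T+Q^\lambda_T$, $\bar S_T=\bar Q_T+Q^\lambda_T$, $g_T=b^\lambda_T$ and, for $0\le t<T$, $$S_t=-A_t^\top S_{t+1}B_t(R_t+B_t^\top S_{t+1}B_t)^{-1}B_t^\top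 S_{t+1}A_t+A_t^\top S_{t+1}A_t+Q_t+Q^\lambda_t,$$ $$\bar S_t=-\bar A_t^\top\bar S_{t+1}B_t(R_t+B_t^\top\bar S_{t+1}B_t)^{-1}B_t^\top\bar S_{t+1}\bar A_t+\bar A_t^\top\bar S_{t+1}\bar A_t+\bar Q_t+Q^\lambda_t,$$ $$K_t=-(R_t+B_t^\top S_{t+1}B_t)^{-1}B_t^\top S_{t+1}A_t,\qquad \bar K_t=-(R_t+B_t^\top\bar S_{t+1}B_t)^{-1}B_t^\top\bar S_{t+1}\bar A_t,$$ $$g_t=(\bar A_t+B_t\bar K_t)^\top(2\bar S_{t+1}\mu+g_{t+1})+b^\lambda_t,$$ $$f_t=-(R_t+B_t^\top\bar S_{t+1}B_t)^{-1}B_t^\top\big(\bar S_{t+1}\mu+\tfrac12g_{t+1}\big).$$ Then all the inverses above exist, $J(\mathbf u)$ is integrable for every admissible $\mathbf u$, and the problem of minimizing $\mathbb E(J(\mathbf u))$ over the admissible controls has a solution, unique up to almost sure equality, namely the control given by $$u^{i*}_t=K_tx^i_t+(\bar K_t-K_t)\bar x_t+f_t,\qquad 1\le i\le k,\ 0\le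 t<T,$$ where $x^i_t$ are the states generated by $\mathbf u^*$ itself. In particular, the optimal control of subsystem $i$ depends on the other subsystems only through the mean-field. -/

import Mathlib

open MeasureTheory ProbabilityTheory
open scoped Matrix

namespace MeanFieldLQ

noncomputable section

/-- Deterministic data of `k` mean-field coupled linear-quadratic subsystems with states in `ℝⁿ`
and controls in `ℝᵐ`: horizon, dynamics matrices, cost matrices, risk parameter and (deterministic)
initial states.  The matrices are used only at times `t < T` (`A`, `B`, `C`, `R`) and `t ≤ T`
(`P`, `Q`). -/
structure Data (k n m : ℕ) where
  T : ℕ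
  A : ℕ → Matrix (Fin n) (Fin n) ℝ
  B : ℕ → Matrix (Fin n) (Fin m) ℝ
  C : ℕ → Matrix (Fin n) (Fin n) ℝ
  P : ℕ → Matrix (Fin n) (Fin n) ℝ
  Q : ℕ → Matrix (Fin n) (Fin n) ℝ
  R : ℕ → Matrix (Fin m) (Fin m) ℝ
  lam : ℝ
  x0 : Fin k → Fin n → ℝ

/-- The quadratic form `vᵀ M v`. -/
def quad {n : ℕ} (M : Matrix (Fin n) (Fin n) ℝ) (v : Fin n → ℝ) : ℝ :=
  v ⬝ᵥ (M *ᵥ v)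

/-- The mean-field `(1/k) ∑ᵢ vⁱ` of `k` vectors. -/
def meanField {k n : ℕ} (v : Fin k → Fin n → ℝ) : Fin n → ℝ :=
  (k : ℝ)⁻¹ • ∑ i, v i

variable {k n m : ℕ} {Ω : Type*}

/-- The state process generated by the control `u` and the disturbance `w`:
`x₀` is given and `xⁱ_{t+1} = A_t xⁱ_t + B_t uⁱ_t + C_t x̄_t + wⁱ_{t+1}`. -/
def state (D : Data k n m) (w : ℕ → Ω → Fin k → Fin n → ℝ) (u : ℕ → Ω → Fin k → Fin m → ℝ) :
    ℕ → Ω → Fin k → Fin n → ℝ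
  | 0 => fun _ => D.x0
  | t + 1 => fun ω i =>
      D.A t *ᵥ state D w u t ω i + D.B t *ᵥ u t ω i
        + D.C t *ᵥ meanField (state D w u t ω) + w (t + 1) ω i

/-- The history `h_t = (x₀, …, x_t, u₀, …, u_{t-1})` of all the subsystems. -/
def history (D : Data k n m) (w : ℕ → Ω → Fin k → Fin n → ℝ) (u : ℕ → Ω → Fin k → Fin m → ℝ)
    (t : ℕ) (ω : Ω) : (Fin (t + 1) → Fin k → Fin n → ℝ) × (Fin t → Fin k → Fin m → ℝ) :=
  (fun s => state D w u s ω, fun s => u s ω)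

/-- The σ-algebra `F_t = σ(h_t)`. -/
@[reducible] def histSigma (D : Data k n m) (w : ℕ → Ω → Fin k → Fin n → ℝ) (u : ℕ → Ω → Fin k → Fin m → ℝ)
    (t : ℕ) : MeasurableSpace Ω :=
  MeasurableSpace.comap (history D w u t) inferInstance

/-- The σ-algebra `F_{t-1}`, where `F_{-1}` is the trivial σ-algebra. -/
@[reducible] def prevSigma (D : Data k n m) (w : ℕ → Ω → Fin k → Fin n → ℝ) (u : ℕ → Ω → Fin k → Fin m → ℝ) :
    ℕ → MeasurableSpace Ω
  | 0 => ⊥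
  | t + 1 => histSigma D w u t

/-- The standard state cost `∑ᵢ (x̄ᵀ P_t x̄ + xⁱᵀ Q_t xⁱ)`. -/
def stateCost (D : Data k n m) (t : ℕ) (x : Fin k → Fin n → ℝ) : ℝ :=
  ∑ i, (quad (D.P t) (meanField x) + quad (D.Q t) (x i))

/-- The standard control cost `∑ᵢ uⁱᵀ R_t uⁱ`. -/
def controlCost (D : Data k n m) (t : ℕ) (u : Fin k → Fin m → ℝ) : ℝ :=
  ∑ i, quad (D.R t) (u i)

variable [MeasurableSpace Ω]

/-- The state-energy prediction error `xⁱ_tᵀ Q_t xⁱ_t - E(xⁱ_tᵀ Q_t xⁱ_t | F_{t-1})`. -/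
def predError (prob : Measure Ω) (D : Data k n m) (w : ℕ → Ω → Fin k → Fin n → ℝ)
    (u : ℕ → Ω → Fin k → Fin m → ℝ) (t : ℕ) (i : Fin k) (ω : Ω) : ℝ :=
  quad (D.Q t) (state D w u t ω i)
    - (prob[fun ω' => quad (D.Q t) (state D w u t ω' i) | prevSigma D w u t]) ω

/-- The risk-aware cost `lam * ∑ᵢ (Δⁱ_t)²`. -/
def riskCost (prob : Measure Ω) (D : Data k n m) (w : ℕ → Ω → Fin k → Fin n → ℝ)
    (u : ℕ → Ω → Fin k → Fin m → ℝ) (t : ℕ) (ω : Ω) : ℝ :=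
  D.lam * ∑ i, (predError prob D w u t i ω) ^ 2

/-- The random total cost `J(u)`. -/
def totalCost (prob : Measure Ω) (D : Data k n m) (w : ℕ → Ω → Fin k → Fin n → ℝ)
    (u : ℕ → Ω → Fin k → Fin m → ℝ) (ω : Ω) : ℝ :=
  stateCost D D.T (state D w u D.T ω) + riskCost prob D w u D.T ω
    + ∑ t ∈ Finset.range D.T,
        (stateCost D t (state D w u t ω) + riskCost prob D w u t ω + controlCost D t (u t ω))

/-- Standing assumptions on the disturbances `w₁, …, w_T`, where `w t ω i` is the disturbance of
subsystem `i`: the stacked vectors are i.i.d. over time, at each time the disturbances of the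
subsystems are i.i.d., and the fourth moments `E‖wⁱ_t‖⁴` (Euclidean norm) are finite. -/
structure DisturbanceAssumption (prob : Measure Ω) (T : ℕ)
    (w : ℕ → Ω → Fin k → Fin n → ℝ) : Prop where
  measurable : ∀ t < T, Measurable (w (t + 1))
  indep_time : iIndepFun (fun t : Fin T => w (t + 1)) prob
  ident_time : ∀ s < T, ∀ t < T, IdentDistrib (w (s + 1)) (w (t + 1)) prob prob
  indep_sub : ∀ t < T, iIndepFun (fun (i : Fin k) ω => w (t + 1) ω i) prob
  ident_sub : ∀ t < T, ∀ i j : Fin k,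
    IdentDistrib (fun ω => w (t + 1) ω i) (fun ω => w (t + 1) ω j) prob prob
  fourth_moment : ∀ t < T, ∀ i : Fin k,
    Integrable (fun ω => (w (t + 1) ω i ⬝ᵥ w (t + 1) ω i) ^ 2) prob

/-- Admissible controls: every `uⁱ_t`, `t < T`, is `F_t`-measurable with `E‖uⁱ_t‖² < ∞`
(Euclidean norm). -/
def Admissible (prob : Measure Ω) (D : Data k n m) (w : ℕ → Ω → Fin k → Fin n → ℝ)
    (u : ℕ → Ω → Fin k → Fin m → ℝ) : Prop :=
  ∀ t < D.T, ∀ i : Fin k,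
    Measurable[histSigma D w u t] (fun ω => u t ω i) ∧
      Integrable (fun ω => u t ω i ⬝ᵥ u t ω i) prob

/-- `u` minimizes the expected total cost among the admissible controls. -/
def IsOptimal (prob : Measure Ω) (D : Data k n m) (w : ℕ → Ω → Fin k → Fin n → ℝ)
    (u : ℕ → Ω → Fin k → Fin m → ℝ) : Prop :=
  Admissible prob D w u ∧
    ∀ v : ℕ → Ω → Fin k → Fin m → ℝ, Admissible prob D w v →
      ∫ ω, totalCost prob D w u ω ∂prob ≤ ∫ ω, totalCost prob D w v ω ∂prob

/-- The mean `μ = E(ξ)`, taken coordinatewise. -/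
def noiseMean (prob : Measure Ω) (ξ : Ω → Fin n → ℝ) : Fin n → ℝ :=
  fun a => ∫ ω, ξ ω a ∂prob

/-- The covariance matrix `Σ = E(d dᵀ)`, where `d = ξ - μ`. -/
def noiseCov (prob : Measure Ω) (ξ : Ω → Fin n → ℝ) : Matrix (Fin n) (Fin n) ℝ :=
  Matrix.of fun a b =>
    ∫ ω, (ξ ω - noiseMean prob ξ) a * (ξ ω - noiseMean prob ξ) b ∂prob

/-- The skew vector `E(d dᵀ Q d)`, where `d = ξ - μ`. -/
def noiseSkew (prob : Measure Ω) (ξ : Ω → Fin n → ℝ) (Q : Matrix (Fin n) (Fin n) ℝ) :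
    Fin n → ℝ :=
  fun a => ∫ ω, (ξ ω - noiseMean prob ξ) a * quad Q (ξ ω - noiseMean prob ξ) ∂prob

/-- `Q_t^λ = 4 λ Q_t Σ Q_t`, for a disturbance distributed as `ξ`. -/
def Qlam (prob : Measure Ω) (D : Data k n m) (ξ : Ω → Fin n → ℝ) (t : ℕ) :
    Matrix (Fin n) (Fin n) ℝ :=
  (4 * D.lam) • (D.Q t * noiseCov prob ξ * D.Q t)

/-- `b_t^λ = 4 λ Q_t γ_t`, for a disturbance distributed as `ξ`. -/
def blam (prob : Measure Ω) (D : Data k n m) (ξ : Ω → Fin n → ℝ) (t : ℕ) : Fin n → ℝ :=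
  (4 * D.lam) • (D.Q t *ᵥ noiseSkew prob ξ (D.Q t))

/-- The matrix `R + Bᵀ S B` that the recursions invert. -/
def pivot (B : Matrix (Fin n) (Fin m) ℝ) (R : Matrix (Fin m) (Fin m) ℝ)
    (S : Matrix (Fin n) (Fin n) ℝ) : Matrix (Fin m) (Fin m) ℝ :=
  R + Bᵀ * S * B

/-- The feedback matrix `-(R + Bᵀ S B)⁻¹ Bᵀ S A`. -/
def gain (A : Matrix (Fin n) (Fin n) ℝ) (B : Matrix (Fin n) (Fin m) ℝ)
    (R : Matrix (Fin m) (Fin m) ℝ) (S : Matrix (Fin n) (Fin n) ℝ) : Matrix (Fin m) (Fin n) ℝ :=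
  -((pivot B R S)⁻¹ * Bᵀ * S * A)

/-- The backward Riccati recursion on `{0, …, T}`: `S_T = M_T` and
`S_t = -A_tᵀ S_{t+1} B_t (R_t + B_tᵀ S_{t+1} B_t)⁻¹ B_tᵀ S_{t+1} A_t + A_tᵀ S_{t+1} A_t + M_t`. -/
def riccati (T : ℕ) (A : ℕ → Matrix (Fin n) (Fin n) ℝ) (B : ℕ → Matrix (Fin n) (Fin m) ℝ)
    (M : ℕ → Matrix (Fin n) (Fin n) ℝ) (R : ℕ → Matrix (Fin m) (Fin m) ℝ) (t : ℕ) :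
    Matrix (Fin n) (Fin n) ℝ :=
  if t < T then
    -((A t)ᵀ * riccati T A B M R (t + 1) * B t
        * (pivot (B t) (R t) (riccati T A B M R (t + 1)))⁻¹
        * (B t)ᵀ * riccati T A B M R (t + 1) * A t)
      + (A t)ᵀ * riccati T A B M R (t + 1) * A t + M t
  else M T
termination_by T - t

/-- `S_t`: the Riccati recursion for `(A_t, Q_t + Q_t^λ)`. -/
def S (prob : Measure Ω) (D : Data k n m) (ξ : Ω → Fin n → ℝ) : ℕ → Matrix (Fin n) (Fin n) ℝ :=
  riccati D.T D.A D.B (fun t => D.Q t + Qlam prob D ξ t) D.R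

/-- `S̄_t`: the Riccati recursion for `(A_t + C_t, P_t + Q_t + Q_t^λ)`. -/
def Sbar (prob : Measure Ω) (D : Data k n m) (ξ : Ω → Fin n → ℝ) :
    ℕ → Matrix (Fin n) (Fin n) ℝ :=
  riccati D.T (fun t => D.A t + D.C t) D.B (fun t => D.P t + D.Q t + Qlam prob D ξ t) D.R

/-- `K_t = -(R_t + B_tᵀ S_{t+1} B_t)⁻¹ B_tᵀ S_{t+1} A_t`. -/
def K (prob : Measure Ω) (D : Data k n m) (ξ : Ω → Fin n → ℝ) (t : ℕ) :
    Matrix (Fin m) (Fin n) ℝ :=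
  gain (D.A t) (D.B t) (D.R t) (S prob D ξ (t + 1))

/-- `K̄_t = -(R_t + B_tᵀ S̄_{t+1} B_t)⁻¹ B_tᵀ S̄_{t+1} (A_t + C_t)`. -/
def Kbar (prob : Measure Ω) (D : Data k n m) (ξ : Ω → Fin n → ℝ) (t : ℕ) :
    Matrix (Fin m) (Fin n) ℝ :=
  gain (D.A t + D.C t) (D.B t) (D.R t) (Sbar prob D ξ (t + 1))

/-- The backward affine recursion: `g_T = b_T^λ` and
`g_t = (A_t + C_t + B_t K̄_t)ᵀ (2 S̄_{t+1} μ + g_{t+1}) + b_t^λ`. -/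
def g (prob : Measure Ω) (D : Data k n m) (ξ : Ω → Fin n → ℝ) (t : ℕ) : Fin n → ℝ :=
  if t < D.T then
    (D.A t + D.C t + D.B t * Kbar prob D ξ t)ᵀ *ᵥ
        ((2 : ℝ) • (Sbar prob D ξ (t + 1) *ᵥ noiseMean prob ξ) + g prob D ξ (t + 1))
      + blam prob D ξ t
  else blam prob D ξ D.T
termination_by D.T - t

/-- `f_t = -(R_t + B_tᵀ S̄_{t+1} B_t)⁻¹ B_tᵀ (S̄_{t+1} μ + g_{t+1} / 2)`. -/
def f (prob : Measure Ω) (D : Data k n m) (ξ : Ω → Fin n → ℝ) (t : ℕ) : Fin m → ℝ :=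
  -(((pivot (D.B t) (D.R t) (Sbar prob D ξ (t + 1)))⁻¹ * (D.B t)ᵀ) *ᵥ
      (Sbar prob D ξ (t + 1) *ᵥ noiseMean prob ξ + (1 / 2 : ℝ) • g prob D ξ (t + 1)))

end

end MeanFieldLQ

/-!
Conditionally on the past, the energy `xᵀ Q x` of a subsystem's next state deviates from its
prediction by a term linear in the centred disturbance plus the centred disturbance energy. The
expected square of this deviation is therefore, up to a constant that no control can influence, a
quadratic plus linear function of the state, and the risk-aware cost becomes a standard cost with
weights `Q + Q^λ` and linear part `b^λ`.

Splitting the states and controls into the mean-field and the deviations from it decouples both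
the cost and the dynamics. Completing the square along the backward recursions in the deviations
(`S`) and in the mean-field (`S̄`, `g`) writes the cost of a control as a constant plus the sum of
the expected values of nonnegative quadratic gaps, which vanish exactly when the feedback law is
applied.
-/

namespace MeanFieldLQ

section QuadraticForms

variable {n m : ℕ}

theorem quad_zero (M : Matrix (Fin n) (Fin n) ℝ) : quad M 0 = 0 := by
  simp [quad]

theorem quad_neg (M : Matrix (Fin n) (Fin n) ℝ) (x : Fin n → ℝ) : quad M (-x) = quad M x := by
  simp [quad, Matrix.mulVec_neg]

theorem quad_add {M : Matrix (Fin n) (Fin n) ℝ} (hM : M.IsSymm) (x y : Fin n → ℝ) :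
    quad M (x + y) = quad M x + 2 * (x ⬝ᵥ M *ᵥ y) + quad M y := by
  have hcomm : y ⬝ᵥ M *ᵥ x = x ⬝ᵥ M *ᵥ y := by
    rw [Matrix.dotProduct_mulVec, ← Matrix.mulVec_transpose, hM.eq, dotProduct_comm]
  simp only [quad, Matrix.mulVec_add, dotProduct_add, add_dotProduct, hcomm]
  ring

theorem quad_sub {M : Matrix (Fin n) (Fin n) ℝ} (hM : M.IsSymm) (x y : Fin n → ℝ) :
    quad M (x - y) = quad M x - 2 * (x ⬝ᵥ M *ᵥ y) + quad M y := by
  rw [sub_eq_add_neg, quad_add hM, quad_neg, Matrix.mulVec_neg, dotProduct_neg]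
  ring

theorem quad_add_left (M N : Matrix (Fin n) (Fin n) ℝ) (x : Fin n → ℝ) :
    quad (M + N) x = quad M x + quad N x := by
  rw [quad, Matrix.add_mulVec, dotProduct_add, quad, quad]

theorem quad_sub_left (M N : Matrix (Fin n) (Fin n) ℝ) (x : Fin n → ℝ) :
    quad (M - N) x = quad M x - quad N x := by
  rw [quad, Matrix.sub_mulVec, dotProduct_sub, quad, quad]

theorem quad_smul_left (c : ℝ) (M : Matrix (Fin n) (Fin n) ℝ) (x : Fin n → ℝ) :
    quad (c • M) x = c * quad M x := by
  rw [quad, Matrix.smul_mulVec, dotProduct_smul, smul_eq_mul, quad]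

theorem quad_mulVec (M : Matrix (Fin n) (Fin n) ℝ) (A : Matrix (Fin n) (Fin m) ℝ)
    (x : Fin m → ℝ) : quad M (A *ᵥ x) = quad (Aᵀ * M * A) x := by
  simp only [quad, ← Matrix.mulVec_mulVec]
  rw [Matrix.dotProduct_mulVec x Aᵀ, Matrix.vecMul_transpose]

theorem quad_nonneg {M : Matrix (Fin n) (Fin n) ℝ} (hM : M.PosSemidef) (x : Fin n → ℝ) :
    0 ≤ quad M x :=
  hM.dotProduct_mulVec_nonneg x

theorem posSemidef_of_quad_nonneg {M : Matrix (Fin n) (Fin n) ℝ} (hM : M.IsSymm)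
    (h : ∀ x, 0 ≤ quad M x) : M.PosSemidef :=
  .of_dotProduct_mulVec_nonneg (Matrix.isHermitian_iff_isSymm.2 hM) h

theorem quad_eq_zero_iff {M : Matrix (Fin n) (Fin n) ℝ} (hM : M.PosDef) {x : Fin n → ℝ} :
    quad M x = 0 ↔ x = 0 := by
  refine ⟨fun h => ?_, fun h => h ▸ quad_zero M⟩
  by_contra hx
  exact (hM.dotProduct_mulVec_pos hx).ne' h

end QuadraticForms

section Riccati

variable {n m : ℕ} {A : Matrix (Fin n) (Fin n) ℝ} {B : Matrix (Fin n) (Fin m) ℝ}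
  {M S : Matrix (Fin n) (Fin n) ℝ} {R : Matrix (Fin m) (Fin m) ℝ}

theorem isSymm_transpose_mul_mul (hS : S.IsSymm) (B : Matrix (Fin n) (Fin m) ℝ) :
    (Bᵀ * S * B).IsSymm := by
  simp only [Matrix.IsSymm, Matrix.transpose_mul, Matrix.transpose_transpose, hS.eq,
    Matrix.mul_assoc]

theorem posDef_pivot (hR : R.PosDef) (hS : S.PosSemidef) (B : Matrix (Fin n) (Fin m) ℝ) :
    (pivot B R S).PosDef :=
  hR.add_posSemidef (hS.conjTranspose_mul_mul_same B)

theorem pivot_mul_gain (hV : IsUnit (pivot B R S)) :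
    pivot B R S * gain A B R S = -(Bᵀ * S * A) := by
  have hdet : IsUnit (pivot B R S).det := (Matrix.isUnit_iff_isUnit_det _).1 hV
  rw [gain, Matrix.mul_neg, Matrix.mul_assoc, Matrix.mul_assoc, Matrix.mul_nonsing_inv_cancel_left
    _ _ hdet, Matrix.mul_assoc]

/-- One step of the Riccati recursion: `M` is the stage weight and `S` the weight of the
cost-to-go at the next time. -/
noncomputable def riccatiStep (A : Matrix (Fin n) (Fin n) ℝ) (B : Matrix (Fin n) (Fin m) ℝ)
    (M : Matrix (Fin n) (Fin n) ℝ) (R : Matrix (Fin m) (Fin m) ℝ)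
    (S : Matrix (Fin n) (Fin n) ℝ) : Matrix (Fin n) (Fin n) ℝ :=
  -(Aᵀ * S * B * (pivot B R S)⁻¹ * Bᵀ * S * A) + Aᵀ * S * A + M

theorem riccatiStep_eq_sub_gain (hS : S.IsSymm) (hVS : (pivot B R S).IsSymm)
    (hV : IsUnit (pivot B R S)) :
    riccatiStep A B M R S
      = M + Aᵀ * S * A - (gain A B R S)ᵀ * pivot B R S * gain A B R S := by
  have hgain : (gain A B R S)ᵀ = -(Aᵀ * S * B * (pivot B R S)⁻¹) := by
    simp only [gain, Matrix.transpose_neg, Matrix.transpose_mul, Matrix.transpose_nonsing_inv,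
      Matrix.transpose_transpose, hS.eq, hVS.eq, Matrix.mul_assoc]
  rw [Matrix.mul_assoc (gain A B R S)ᵀ, pivot_mul_gain hV, hgain, riccatiStep, Matrix.neg_mul,
    Matrix.mul_neg, neg_neg]
  simp only [Matrix.mul_assoc]
  abel

theorem isSymm_riccatiStep (A : Matrix (Fin n) (Fin n) ℝ) (hM : M.IsSymm) (hS : S.IsSymm)
    (hVS : (pivot B R S).IsSymm) (hV : IsUnit (pivot B R S)) :
    (riccatiStep A B M R S).IsSymm := by
  rw [riccatiStep_eq_sub_gain hS hVS hV]
  exact (hM.add (isSymm_transpose_mul_mul hS A)).sub (isSymm_transpose_mul_mul hVS _)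

theorem quad_riccatiStep (hS : S.IsSymm) (hVS : (pivot B R S).IsSymm)
    (hV : IsUnit (pivot B R S)) (x : Fin n → ℝ) :
    quad (riccatiStep A B M R S) x
      = quad M x + quad S (A *ᵥ x) - quad (pivot B R S) (gain A B R S *ᵥ x) := by
  rw [riccatiStep_eq_sub_gain hS hVS hV, quad_sub_left, quad_add_left, ← quad_mulVec,
    ← quad_mulVec]

theorem quad_add_quad_add_dotProduct (hS : S.IsSymm) (hVS : (pivot B R S).IsSymm)
    {a h : Fin n → ℝ} {v : Fin m → ℝ}
    (hv : pivot B R S *ᵥ v = -(Bᵀ *ᵥ (S *ᵥ a + (1 / 2 : ℝ) • h))) (u : Fin m → ℝ) :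
    quad R u + (quad S (a + B *ᵥ u) + h ⬝ᵥ (a + B *ᵥ u)) =
      quad (pivot B R S) (u - v) + (quad S a + h ⬝ᵥ a - quad (pivot B R S) v) := by
  have hcross : u ⬝ᵥ pivot B R S *ᵥ v
      = -((B *ᵥ u) ⬝ᵥ S *ᵥ a + (1 / 2) * ((B *ᵥ u) ⬝ᵥ h)) := by
    rw [hv, dotProduct_neg, Matrix.dotProduct_mulVec, Matrix.vecMul_transpose, dotProduct_add,
      dotProduct_smul, smul_eq_mul]
  have hpivot : quad (pivot B R S) u = quad R u + quad S (B *ᵥ u) := by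
    rw [pivot, quad_add_left, quad_mulVec]
  rw [quad_sub hVS, hcross, hpivot, add_comm a, quad_add hS, dotProduct_add,
    dotProduct_comm h (B *ᵥ u)]
  ring

theorem quad_gain_add (hVS : (pivot B R S).IsSymm)
    {p h : Fin n → ℝ} {f : Fin m → ℝ}
    (hf : pivot B R S *ᵥ f = -(Bᵀ *ᵥ (S *ᵥ p + (1 / 2 : ℝ) • h))) (x : Fin n → ℝ) :
    quad (pivot B R S) (gain A B R S *ᵥ x + f)
      = quad (pivot B R S) (gain A B R S *ᵥ x) + quad (pivot B R S) f
        - ((B * gain A B R S)ᵀ *ᵥ ((2 : ℝ) • (S *ᵥ p) + h)) ⬝ᵥ x := by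
  have hcross : (gain A B R S *ᵥ x) ⬝ᵥ pivot B R S *ᵥ f
      = -(1 / 2) * (((B * gain A B R S)ᵀ *ᵥ ((2 : ℝ) • (S *ᵥ p) + h)) ⬝ᵥ x) := by
    rw [hf, dotProduct_neg, Matrix.dotProduct_mulVec, Matrix.vecMul_transpose,
      Matrix.mulVec_transpose, ← Matrix.dotProduct_mulVec, Matrix.mulVec_mulVec,
      dotProduct_comm (_ + _) ((B * _) *ᵥ x)]
    simp only [dotProduct_add, dotProduct_smul, smul_eq_mul]
    ring
  rw [quad_add hVS, hcross]
  ring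

theorem complete_square (hS : S.IsSymm) (hVS : (pivot B R S).IsSymm) (hV : IsUnit (pivot B R S))
    {p h : Fin n → ℝ} {f : Fin m → ℝ}
    (hf : pivot B R S *ᵥ f = -(Bᵀ *ᵥ (S *ᵥ p + (1 / 2 : ℝ) • h))) (x : Fin n → ℝ)
    (u : Fin m → ℝ) :
    quad M x + quad R u + (quad S (A *ᵥ x + p + B *ᵥ u) + h ⬝ᵥ (A *ᵥ x + p + B *ᵥ u)) =
      quad (riccatiStep A B M R S) x
        + ((A + B * gain A B R S)ᵀ *ᵥ ((2 : ℝ) • (S *ᵥ p) + h)) ⬝ᵥ x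
        + quad (pivot B R S) (u - (gain A B R S *ᵥ x + f))
        + (quad S p + h ⬝ᵥ p - quad (pivot B R S) f) := by
  have hv : pivot B R S *ᵥ (gain A B R S *ᵥ x + f)
      = -(Bᵀ *ᵥ (S *ᵥ (A *ᵥ x + p) + (1 / 2 : ℝ) • h)) := by
    rw [Matrix.mulVec_add, hf, Matrix.mulVec_mulVec, pivot_mul_gain hV, Matrix.neg_mulVec,
      ← neg_add, ← Matrix.mulVec_mulVec, ← Matrix.mulVec_mulVec, ← Matrix.mulVec_add,
      Matrix.mulVec_add S, add_assoc]
  have hA : (Aᵀ *ᵥ ((2 : ℝ) • (S *ᵥ p) + h)) ⬝ᵥ x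
      = 2 * ((A *ᵥ x) ⬝ᵥ S *ᵥ p) + h ⬝ᵥ A *ᵥ x := by
    rw [Matrix.mulVec_transpose, ← Matrix.dotProduct_mulVec, add_dotProduct, smul_dotProduct,
      smul_eq_mul, dotProduct_comm (S *ᵥ p)]
  rw [add_assoc, quad_add_quad_add_dotProduct hS hVS hv, quad_gain_add hVS hf,
    quad_riccatiStep hS hVS hV, quad_add hS, dotProduct_add, Matrix.transpose_add,
    Matrix.add_mulVec, add_dotProduct, hA]
  ring

theorem complete_square_homogeneous (hS : S.IsSymm) (hVS : (pivot B R S).IsSymm)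
    (hV : IsUnit (pivot B R S)) (x : Fin n → ℝ) (u : Fin m → ℝ) :
    quad M x + quad R u + quad S (A *ᵥ x + B *ᵥ u) =
      quad (riccatiStep A B M R S) x + quad (pivot B R S) (u - gain A B R S *ᵥ x) := by
  simpa [quad_zero] using
    complete_square (A := A) (M := M) (p := 0) (h := 0) (f := 0) hS hVS hV (by simp) x u

theorem posSemidef_riccatiStep (A : Matrix (Fin n) (Fin n) ℝ) (B : Matrix (Fin n) (Fin m) ℝ)
    (hM : M.PosSemidef) (hR : R.PosDef) (hS : S.PosSemidef) :
    (riccatiStep A B M R S).PosSemidef := by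
  have hV := posDef_pivot hR hS B
  have hSS := Matrix.isHermitian_iff_isSymm.1 hS.isHermitian
  have hVS := Matrix.isHermitian_iff_isSymm.1 hV.isHermitian
  refine posSemidef_of_quad_nonneg (isSymm_riccatiStep A
    (Matrix.isHermitian_iff_isSymm.1 hM.isHermitian) hSS hVS hV.isUnit) fun x => ?_
  have hsq := complete_square_homogeneous (A := A) (M := M) hSS hVS hV.isUnit x
    (gain A B R S *ᵥ x)
  rw [sub_self, quad_zero, add_zero] at hsq
  rw [← hsq]
  exact add_nonneg (add_nonneg (quad_nonneg hM _) (quad_nonneg hR.posSemidef _)) (quad_nonneg hS _)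

end Riccati

section RiccatiRecursion

variable {n m T t : ℕ} {A : ℕ → Matrix (Fin n) (Fin n) ℝ} {B : ℕ → Matrix (Fin n) (Fin m) ℝ}
  {M : ℕ → Matrix (Fin n) (Fin n) ℝ} {R : ℕ → Matrix (Fin m) (Fin m) ℝ}

theorem riccati_of_lt (ht : t < T) :
    riccati T A B M R t = riccatiStep (A t) (B t) (M t) (R t) (riccati T A B M R (t + 1)) := by
  rw [riccati, if_pos ht, riccatiStep]

theorem riccati_self : riccati T A B M R T = M T := by
  rw [riccati, if_neg (lt_irrefl T)]

theorem isSymm_riccati (hM : ∀ t ≤ T, (M t).IsSymm)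
    (hV : ∀ t < T, (pivot (B t) (R t) (riccati T A B M R (t + 1))).PosDef) (ht : t ≤ T) :
    (riccati T A B M R t).IsSymm := by
  induction ht using Nat.decreasingInduction with
  | self => exact riccati_self ▸ hM T le_rfl
  | of_succ t ht ih =>
    rw [riccati_of_lt ht]
    exact isSymm_riccatiStep _ (hM t ht.le) ih
      (Matrix.isHermitian_iff_isSymm.1 (hV t ht).isHermitian) (hV t ht).isUnit

theorem posSemidef_riccati (hM : ∀ t ≤ T, (M t).PosSemidef) (hR : ∀ t < T, (R t).PosDef)
    (ht : t ≤ T) : (riccati T A B M R t).PosSemidef := by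
  induction ht using Nat.decreasingInduction with
  | self => exact riccati_self ▸ hM T le_rfl
  | of_succ t ht ih =>
    rw [riccati_of_lt ht]
    exact posSemidef_riccatiStep _ _ (hM t ht.le) (hR t ht) ih

end RiccatiRecursion

section MeanField

variable {k n m : ℕ}

theorem meanField_add (v v' : Fin k → Fin n → ℝ) :
    meanField (v + v') = meanField v + meanField v' := by
  simp only [meanField, Pi.add_apply, Finset.sum_add_distrib, smul_add]

theorem meanField_const [NeZero k] (v : Fin n → ℝ) : meanField (fun _ : Fin k => v) = v := by
  have hk : (k : ℝ) ≠ 0 := NeZero.ne _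
  rw [meanField, Finset.sum_const, Finset.card_univ, Fintype.card_fin, ← Nat.cast_smul_eq_nsmul ℝ,
    inv_smul_smul₀ hk]

theorem meanField_mulVec (A : Matrix (Fin m) (Fin n) ℝ) (v : Fin k → Fin n → ℝ) :
    meanField (fun i => A *ᵥ v i) = A *ᵥ meanField v := by
  rw [meanField, meanField, Matrix.mulVec_smul, Matrix.mulVec_sum]

theorem sum_eq_smul_meanField [NeZero k] (v : Fin k → Fin n → ℝ) :
    ∑ i, v i = (k : ℝ) • meanField v := by
  have hk : (k : ℝ) ≠ 0 := NeZero.ne _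
  rw [meanField, smul_inv_smul₀ hk]

theorem sum_dotProduct_eq_meanField [NeZero k] (b : Fin n → ℝ) (v : Fin k → Fin n → ℝ) :
    ∑ i, b ⬝ᵥ v i = k * (b ⬝ᵥ meanField v) := by
  rw [← dotProduct_sum, sum_eq_smul_meanField, dotProduct_smul, smul_eq_mul]

theorem sum_quad_eq_deviation_add_meanField [NeZero k] {M : Matrix (Fin n) (Fin n) ℝ}
    (hM : M.IsSymm) (v : Fin k → Fin n → ℝ) :
    ∑ i, quad M (v i) = ∑ i, quad M (v i - meanField v) + k * quad M (meanField v) := by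
  have hcross : ∑ i, v i ⬝ᵥ M *ᵥ meanField v = k * quad M (meanField v) := by
    simp only [dotProduct_comm _ (M *ᵥ meanField v)]
    rw [sum_dotProduct_eq_meanField, dotProduct_comm, quad]
  simp only [quad_sub hM, Finset.sum_add_distrib, Finset.sum_sub_distrib, ← Finset.mul_sum, hcross,
    Finset.sum_const, Finset.card_univ, Fintype.card_fin, nsmul_eq_mul]
  ring

end MeanField

section DynamicProgramming

variable {k n m : ℕ} {Ω : Type*} [MeasurableSpace Ω] {prob : Measure Ω} {D : Data k n m}
  {ξ : Ω → Fin n → ℝ} {t : ℕ}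

theorem isSymm_noiseCov (prob : Measure Ω) (ξ : Ω → Fin n → ℝ) : (noiseCov prob ξ).IsSymm :=
  .ext fun _ _ => integral_congr_ae (.of_forall fun _ => mul_comm _ _)

theorem isSymm_Qlam (prob : Measure Ω) (ξ : Ω → Fin n → ℝ) (hQ : (D.Q t).IsSymm) :
    (Qlam prob D ξ t).IsSymm := by
  have hsandwich := isSymm_transpose_mul_mul (isSymm_noiseCov prob ξ) (D.Q t)
  rw [hQ.eq] at hsandwich
  exact hsandwich.smul _

/-- The problem is solvable by completing squares: the state weights are symmetric, and the
matrices inverted in the two Riccati recursions are positive definite. The weights themselves may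
be indefinite. -/
structure RiccatiRegular (prob : Measure Ω) (D : Data k n m) (ξ : Ω → Fin n → ℝ) : Prop where
  isSymm_P : ∀ t ≤ D.T, (D.P t).IsSymm
  isSymm_Q : ∀ t ≤ D.T, (D.Q t).IsSymm
  posDef_pivot_S : ∀ t < D.T, (pivot (D.B t) (D.R t) (S prob D ξ (t + 1))).PosDef
  posDef_pivot_Sbar : ∀ t < D.T, (pivot (D.B t) (D.R t) (Sbar prob D ξ (t + 1))).PosDef

theorem riccatiRegular_of_posSemidef (hP : ∀ t ≤ D.T, (D.P t).PosSemidef)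
    (hQ : ∀ t ≤ D.T, (D.Q t).PosSemidef) (hR : ∀ t < D.T, (D.R t).PosDef)
    (hQlam : ∀ t ≤ D.T, (Qlam prob D ξ t).PosSemidef) : RiccatiRegular prob D ξ where
  isSymm_P t ht := Matrix.isHermitian_iff_isSymm.1 (hP t ht).isHermitian
  isSymm_Q t ht := Matrix.isHermitian_iff_isSymm.1 (hQ t ht).isHermitian
  posDef_pivot_S t ht := posDef_pivot (hR t ht)
    (posSemidef_riccati (fun s hs => (hQ s hs).add (hQlam s hs)) hR ht) _
  posDef_pivot_Sbar t ht := posDef_pivot (hR t ht)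
    (posSemidef_riccati (fun s hs => ((hP s hs).add (hQ s hs)).add (hQlam s hs)) hR ht) _

namespace RiccatiRegular

theorem isSymm_pivot_S (h : RiccatiRegular prob D ξ) (ht : t < D.T) :
    (pivot (D.B t) (D.R t) (S prob D ξ (t + 1))).IsSymm :=
  Matrix.isHermitian_iff_isSymm.1 (h.posDef_pivot_S t ht).isHermitian

theorem isSymm_pivot_Sbar (h : RiccatiRegular prob D ξ) (ht : t < D.T) :
    (pivot (D.B t) (D.R t) (Sbar prob D ξ (t + 1))).IsSymm :=
  Matrix.isHermitian_iff_isSymm.1 (h.posDef_pivot_Sbar t ht).isHermitian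

theorem isSymm_adjusted (h : RiccatiRegular prob D ξ) (ht : t ≤ D.T) :
    (D.Q t + Qlam prob D ξ t).IsSymm :=
  (h.isSymm_Q t ht).add (isSymm_Qlam prob ξ (h.isSymm_Q t ht))

theorem isSymm_S (h : RiccatiRegular prob D ξ) (ht : t ≤ D.T) : (S prob D ξ t).IsSymm :=
  isSymm_riccati (fun _ hs => h.isSymm_adjusted hs) h.posDef_pivot_S ht

theorem isSymm_Sbar (h : RiccatiRegular prob D ξ) (ht : t ≤ D.T) : (Sbar prob D ξ t).IsSymm :=
  isSymm_riccati (fun s hs => ((h.isSymm_P s hs).add (h.isSymm_Q s hs)).add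
    (isSymm_Qlam prob ξ (h.isSymm_Q s hs))) h.posDef_pivot_Sbar ht

theorem isSymm_R (h : RiccatiRegular prob D ξ) (ht : t < D.T) : (D.R t).IsSymm := by
  simpa [pivot] using (h.isSymm_pivot_S ht).sub
    (isSymm_transpose_mul_mul (h.isSymm_S (Nat.succ_le_of_lt ht)) (D.B t))

end RiccatiRegular

/-- The candidate optimal controls in the states `x`. -/
noncomputable def feedback (prob : Measure Ω) (D : Data k n m) (ξ : Ω → Fin n → ℝ) (t : ℕ)
    (x : Fin k → Fin n → ℝ) : Fin k → Fin m → ℝ :=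
  fun i => K prob D ξ t *ᵥ x i + (Kbar prob D ξ t - K prob D ξ t) *ᵥ meanField x + f prob D ξ t

/-- The excess cost incurred at time `t` by applying the controls `u` instead of the feedback in
the states `x`: the two squares left over by completing the square in the deviations
`uⁱ - ū` and in the mean `ū`. -/
noncomputable def gap (prob : Measure Ω) (D : Data k n m) (ξ : Ω → Fin n → ℝ) (t : ℕ)
    (x : Fin k → Fin n → ℝ) (u : Fin k → Fin m → ℝ) : ℝ :=
  ∑ i, quad (pivot (D.B t) (D.R t) (S prob D ξ (t + 1)))
      (u i - meanField u - K prob D ξ t *ᵥ (x i - meanField x))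
    + k * quad (pivot (D.B t) (D.R t) (Sbar prob D ξ (t + 1)))
      (meanField u - (Kbar prob D ξ t *ᵥ meanField x + f prob D ξ t))

/-- The optimal cost-to-go at time `t` as a function of the states, up to an additive constant. -/
noncomputable def value (prob : Measure Ω) (D : Data k n m) (ξ : Ω → Fin n → ℝ) (t : ℕ)
    (x : Fin k → Fin n → ℝ) : ℝ :=
  ∑ i, quad (S prob D ξ t) (x i - meanField x)
    + k * (quad (Sbar prob D ξ t) (meanField x) + g prob D ξ t ⬝ᵥ meanField x)

/-- The part of the expected risk cost at time `t` that depends on the states `x`. -/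
noncomputable def riskAdjustment (prob : Measure Ω) (D : Data k n m) (ξ : Ω → Fin n → ℝ) (t : ℕ)
    (x : Fin k → Fin n → ℝ) : ℝ :=
  ∑ i, (quad (Qlam prob D ξ t) (x i) + blam prob D ξ t ⬝ᵥ x i)

/-- The undisturbed successor of the states `x` under the controls `u`. -/
noncomputable def drift (D : Data k n m) (t : ℕ) (x : Fin k → Fin n → ℝ) (u : Fin k → Fin m → ℝ) :
    Fin k → Fin n → ℝ :=
  fun i => D.A t *ᵥ x i + D.B t *ᵥ u i + D.C t *ᵥ meanField x

theorem gap_nonneg (h : RiccatiRegular prob D ξ) (ht : t < D.T) (x : Fin k → Fin n → ℝ)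
    (u : Fin k → Fin m → ℝ) : 0 ≤ gap prob D ξ t x u :=
  add_nonneg (Finset.sum_nonneg fun _ _ => quad_nonneg (h.posDef_pivot_S t ht).posSemidef _)
    (mul_nonneg k.cast_nonneg (quad_nonneg (h.posDef_pivot_Sbar t ht).posSemidef _))

theorem eq_feedback_of_gap_eq_zero [NeZero k] (h : RiccatiRegular prob D ξ) (ht : t < D.T)
    {x : Fin k → Fin n → ℝ} {u : Fin k → Fin m → ℝ} (h0 : gap prob D ξ t x u = 0) :
    u = feedback prob D ξ t x := by
  have hk : (0 : ℝ) < k := Nat.cast_pos.2 (NeZero.pos k)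
  have hdev_nonneg : ∀ i ∈ Finset.univ, 0 ≤ quad (pivot (D.B t) (D.R t) (S prob D ξ (t + 1)))
      (u i - meanField u - K prob D ξ t *ᵥ (x i - meanField x)) :=
    fun _ _ => quad_nonneg (h.posDef_pivot_S t ht).posSemidef _
  obtain ⟨hdev, hmean⟩ := (add_eq_zero_iff_of_nonneg (Finset.sum_nonneg hdev_nonneg)
    (mul_nonneg hk.le (quad_nonneg (h.posDef_pivot_Sbar t ht).posSemidef _))).1 h0
  rw [mul_eq_zero, or_iff_right hk.ne', quad_eq_zero_iff (h.posDef_pivot_Sbar t ht)] at hmean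
  rw [Finset.sum_eq_zero_iff_of_nonneg hdev_nonneg] at hdev
  funext i
  have hi := (quad_eq_zero_iff (h.posDef_pivot_S t ht)).1 (hdev i (Finset.mem_univ i))
  rw [sub_sub, sub_eq_zero] at hi
  rw [hi, sub_eq_zero.1 hmean, feedback, Matrix.sub_mulVec, Matrix.mulVec_sub]
  abel

theorem meanField_feedback [NeZero k] (prob : Measure Ω) (D : Data k n m) (ξ : Ω → Fin n → ℝ)
    (t : ℕ) (x : Fin k → Fin n → ℝ) :
    meanField (feedback prob D ξ t x)
      = Kbar prob D ξ t *ᵥ meanField x + f prob D ξ t := by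
  have hsplit : feedback prob D ξ t x
      = (fun i => K prob D ξ t *ᵥ x i)
        + fun _ => (Kbar prob D ξ t - K prob D ξ t) *ᵥ meanField x + f prob D ξ t := by
    funext i
    exact add_assoc _ _ _
  rw [hsplit, meanField_add, meanField_mulVec, meanField_const, Matrix.sub_mulVec]
  abel

theorem gap_feedback [NeZero k] (prob : Measure Ω) (D : Data k n m) (ξ : Ω → Fin n → ℝ) (t : ℕ)
    (x : Fin k → Fin n → ℝ) :
    gap prob D ξ t x (feedback prob D ξ t x) = 0 := by
  have hdev : ∀ i, feedback prob D ξ t x i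
      - (Kbar prob D ξ t *ᵥ meanField x + f prob D ξ t)
      - K prob D ξ t *ᵥ (x i - meanField x) = 0 := fun i => by
    rw [feedback, Matrix.sub_mulVec, Matrix.mulVec_sub]
    abel
  simp only [gap, meanField_feedback, hdev, sub_self, quad_zero, Finset.sum_const_zero, mul_zero,
    add_zero]

theorem stateCost_add_riskAdjustment [NeZero k] (h : RiccatiRegular prob D ξ) (ht : t ≤ D.T)
    (x : Fin k → Fin n → ℝ) :
    stateCost D t x + riskAdjustment prob D ξ t x
      = ∑ i, quad (D.Q t + Qlam prob D ξ t) (x i - meanField x)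
        + k * (quad (D.P t + D.Q t + Qlam prob D ξ t) (meanField x)
          + blam prob D ξ t ⬝ᵥ meanField x) := by
  have hdev := sum_quad_eq_deviation_add_meanField (h.isSymm_adjusted ht) x
  simp only [quad_add_left, Finset.sum_add_distrib] at hdev
  simp only [stateCost, riskAdjustment, quad_add_left, Finset.sum_add_distrib,
    sum_dotProduct_eq_meanField, Finset.sum_const, Finset.card_univ, Fintype.card_fin,
    nsmul_eq_mul]
  linear_combination hdev

theorem value_terminal [NeZero k] (h : RiccatiRegular prob D ξ) (x : Fin k → Fin n → ℝ) :
    value prob D ξ D.T x = stateCost D D.T x + riskAdjustment prob D ξ D.T x := by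
  have hg : g prob D ξ D.T = blam prob D ξ D.T := by rw [g, if_neg (lt_irrefl _)]
  rw [stateCost_add_riskAdjustment h le_rfl, value, hg, S, Sbar, riccati_self, riccati_self]

theorem meanField_drift_add_const [NeZero k] (D : Data k n m) (t : ℕ) (x : Fin k → Fin n → ℝ)
    (u : Fin k → Fin m → ℝ) (μ : Fin n → ℝ) :
    meanField (drift D t x u + fun _ => μ)
      = (D.A t + D.C t) *ᵥ meanField x + μ + D.B t *ᵥ meanField u := by
  have hsplit : (drift D t x u + fun _ => μ) = ((fun i => D.A t *ᵥ x i) + fun i => D.B t *ᵥ u i)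
      + fun _ => D.C t *ᵥ meanField x + μ := by
    funext i
    simp only [drift, Pi.add_apply, add_assoc]
  rw [hsplit, meanField_add, meanField_add, meanField_mulVec, meanField_mulVec, meanField_const,
    Matrix.add_mulVec]
  abel

theorem drift_add_const_sub_meanField [NeZero k] (D : Data k n m) (t : ℕ)
    (x : Fin k → Fin n → ℝ) (u : Fin k → Fin m → ℝ) (μ : Fin n → ℝ) (i : Fin k) :
    drift D t x u i + μ - meanField (drift D t x u + fun _ => μ)
      = D.A t *ᵥ (x i - meanField x) + D.B t *ᵥ (u i - meanField u) := by
  rw [meanField_drift_add_const, drift, Matrix.add_mulVec, Matrix.mulVec_sub, Matrix.mulVec_sub]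
  abel

theorem pivot_mulVec_f (h : RiccatiRegular prob D ξ) (ht : t < D.T) :
    pivot (D.B t) (D.R t) (Sbar prob D ξ (t + 1)) *ᵥ f prob D ξ t
      = -((D.B t)ᵀ *ᵥ (Sbar prob D ξ (t + 1) *ᵥ noiseMean prob ξ
        + (1 / 2 : ℝ) • g prob D ξ (t + 1))) := by
  have hdet := (Matrix.isUnit_iff_isUnit_det _).1 (h.posDef_pivot_Sbar t ht).isUnit
  rw [f, Matrix.mulVec_neg, Matrix.mulVec_mulVec, Matrix.mul_nonsing_inv_cancel_left _ _ hdet]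

theorem deviation_dynamic_programming (h : RiccatiRegular prob D ξ) (ht : t < D.T)
    (y : Fin n → ℝ) (v : Fin m → ℝ) :
    quad (D.Q t + Qlam prob D ξ t) y + quad (D.R t) v
        + quad (S prob D ξ (t + 1)) (D.A t *ᵥ y + D.B t *ᵥ v)
      = quad (S prob D ξ t) y
        + quad (pivot (D.B t) (D.R t) (S prob D ξ (t + 1))) (v - K prob D ξ t *ᵥ y) := by
  have hstep : S prob D ξ t = riccatiStep (D.A t) (D.B t) (D.Q t + Qlam prob D ξ t) (D.R t)
      (S prob D ξ (t + 1)) := riccati_of_lt ht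
  rw [hstep, complete_square_homogeneous (h.isSymm_S (Nat.succ_le_of_lt ht)) (h.isSymm_pivot_S ht)
    (h.posDef_pivot_S t ht).isUnit, K]

theorem mean_dynamic_programming (h : RiccatiRegular prob D ξ) (ht : t < D.T) :
    ∃ c : ℝ, ∀ (y : Fin n → ℝ) (v : Fin m → ℝ),
      quad (D.P t + D.Q t + Qlam prob D ξ t) y + blam prob D ξ t ⬝ᵥ y + quad (D.R t) v
          + (quad (Sbar prob D ξ (t + 1)) ((D.A t + D.C t) *ᵥ y + noiseMean prob ξ + D.B t *ᵥ v)
            + g prob D ξ (t + 1) ⬝ᵥ ((D.A t + D.C t) *ᵥ y + noiseMean prob ξ + D.B t *ᵥ v))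
        = quad (Sbar prob D ξ t) y + g prob D ξ t ⬝ᵥ y
          + quad (pivot (D.B t) (D.R t) (Sbar prob D ξ (t + 1)))
            (v - (Kbar prob D ξ t *ᵥ y + f prob D ξ t)) + c := by
  refine ⟨quad (Sbar prob D ξ (t + 1)) (noiseMean prob ξ)
    + g prob D ξ (t + 1) ⬝ᵥ noiseMean prob ξ
    - quad (pivot (D.B t) (D.R t) (Sbar prob D ξ (t + 1))) (f prob D ξ t), fun y v => ?_⟩
  have hstep : Sbar prob D ξ t = riccatiStep (D.A t + D.C t) (D.B t)
      (D.P t + D.Q t + Qlam prob D ξ t) (D.R t) (Sbar prob D ξ (t + 1)) := riccati_of_lt ht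
  have hg : g prob D ξ t = (D.A t + D.C t + D.B t * Kbar prob D ξ t)ᵀ *ᵥ
        ((2 : ℝ) • (Sbar prob D ξ (t + 1) *ᵥ noiseMean prob ξ) + g prob D ξ (t + 1))
      + blam prob D ξ t := by rw [g, if_pos ht]
  have hsq := complete_square (A := D.A t + D.C t) (M := D.P t + D.Q t + Qlam prob D ξ t)
    (h.isSymm_Sbar (Nat.succ_le_of_lt ht)) (h.isSymm_pivot_Sbar ht)
    (h.posDef_pivot_Sbar t ht).isUnit (pivot_mulVec_f h ht) y v
  rw [← hstep, ← Kbar] at hsq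
  rw [hg, add_dotProduct]
  linear_combination hsq

theorem dynamic_programming [NeZero k] (h : RiccatiRegular prob D ξ) (ht : t < D.T) :
    ∃ c : ℝ, ∀ (x : Fin k → Fin n → ℝ) (u : Fin k → Fin m → ℝ),
      stateCost D t x + riskAdjustment prob D ξ t x + controlCost D t u
          + value prob D ξ (t + 1) (drift D t x u + fun _ => noiseMean prob ξ)
        = value prob D ξ t x + gap prob D ξ t x u + c := by
  obtain ⟨c, hmean⟩ := mean_dynamic_programming h ht
  refine ⟨k * c, fun x u => ?_⟩
  have hdev := Finset.sum_congr (rfl : (Finset.univ : Finset (Fin k)) = _) fun i _ =>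
    deviation_dynamic_programming h ht (x i - meanField x) (u i - meanField u)
  simp only [Finset.sum_add_distrib] at hdev
  rw [stateCost_add_riskAdjustment h ht.le, controlCost,
    sum_quad_eq_deviation_add_meanField (h.isSymm_R ht)]
  simp only [value, gap, Pi.add_apply, drift_add_const_sub_meanField]
  rw [meanField_drift_add_const]
  linear_combination hdev + (k : ℝ) * hmean (meanField x) (meanField u)

end DynamicProgramming

section QuadraticFormIdentities

variable {n : ℕ}

theorem quad_eq_dotProduct (M : Matrix (Fin n) (Fin n) ℝ) (x : Fin n → ℝ) :
    quad M x = (fun p : Fin n × Fin n => x p.1 * x p.2) ⬝ᵥ fun p => M p.1 p.2 := by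
  simp only [quad, dotProduct, Matrix.mulVec, Fintype.sum_prod_type, Finset.mul_sum]
  exact Finset.sum_congr rfl fun _ _ => Finset.sum_congr rfl fun _ _ => by ring

theorem sq_dotProduct_eq_quad (x d : Fin n → ℝ) :
    (x ⬝ᵥ d) ^ 2 = quad (Matrix.vecMulVec d d) x := by
  rw [quad, Matrix.vecMulVec_mulVec, dotProduct_comm d x, op_smul_eq_smul, dotProduct_smul,
    smul_eq_mul, sq]

theorem mulVec_dotProduct {Q : Matrix (Fin n) (Fin n) ℝ} (hQ : Q.IsSymm) (x y : Fin n → ℝ) :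
    (Q *ᵥ x) ⬝ᵥ y = x ⬝ᵥ Q *ᵥ y := by
  rw [Matrix.dotProduct_mulVec, ← Matrix.mulVec_transpose, hQ.eq]

end QuadraticFormIdentities

section RandomVectors

variable {k n m : ℕ} {ι Ω : Type*} [Fintype ι] {mΩ : MeasurableSpace Ω} {prob : Measure Ω}
  {p q r : ENNReal}

@[fun_prop]
theorem measurable_mulVec (A : Matrix (Fin m) (Fin n) ℝ) :
    Measurable fun x : Fin n → ℝ => A *ᵥ x :=
  (continuous_const.matrix_mulVec continuous_id).measurable

@[fun_prop]
theorem measurable_quad (M : Matrix (Fin n) (Fin n) ℝ) : Measurable (quad M) :=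
  (continuous_id.dotProduct (continuous_const.matrix_mulVec continuous_id)).measurable

theorem measurable_meanField : Measurable (meanField : (Fin k → Fin n → ℝ) → Fin n → ℝ) := by
  unfold meanField
  fun_prop

theorem memLp_two_of_memLp_four {E : Type*} [NormedAddCommGroup E] [IsFiniteMeasure prob]
    {η : Ω → E} (hη : MemLp η 4 prob) : MemLp η 2 prob :=
  hη.mono_exponent (by norm_num)

theorem memLp_mulVec (A : Matrix (Fin m) (Fin n) ℝ) {y : Ω → Fin n → ℝ} (hy : MemLp y p prob) :
    MemLp (fun ω => A *ᵥ y ω) p prob :=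
  A.mulVecLin.toContinuousLinearMap.comp_memLp' hy

theorem memLp_meanField {y : Ω → Fin k → Fin n → ℝ} (hy : MemLp y p prob) :
    MemLp (fun ω => meanField (y ω)) p prob :=
  (memLp_finsetSum Finset.univ fun i _ => hy.eval i).const_smul (k : ℝ)⁻¹

theorem memLp_dotProduct [ENNReal.HolderTriple p q r] {y z : Ω → ι → ℝ} (hy : MemLp y p prob)
    (hz : MemLp z q prob) : MemLp (fun ω => y ω ⬝ᵥ z ω) r prob :=
  memLp_finsetSum Finset.univ fun a _ => (hz.eval a).mul' (hy.eval a)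

theorem memLp_quad [ENNReal.HolderTriple p p r] {y : Ω → Fin n → ℝ} (hy : MemLp y p prob)
    (M : Matrix (Fin n) (Fin n) ℝ) : MemLp (fun ω => quad M (y ω)) r prob :=
  memLp_dotProduct hy (memLp_mulVec M hy)

theorem integrable_dotProduct {y z : Ω → ι → ℝ} (hy : MemLp y 2 prob) (hz : MemLp z 2 prob) :
    Integrable (fun ω => y ω ⬝ᵥ z ω) prob :=
  memLp_one_iff_integrable.1 (memLp_dotProduct hy hz)

theorem integrable_quad {y : Ω → Fin n → ℝ} (hy : MemLp y 2 prob)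
    (M : Matrix (Fin n) (Fin n) ℝ) : Integrable (fun ω => quad M (y ω)) prob :=
  memLp_one_iff_integrable.1 (memLp_quad hy M)

theorem memLp_of_integrable_dotProduct_self_pow {y : Ω → ι → ℝ} {j : ℕ} (hj : j ≠ 0)
    (hm : AEStronglyMeasurable y prob) (hy : Integrable (fun ω => (y ω ⬝ᵥ y ω) ^ j) prob) :
    MemLp y (2 * j : ℕ) prob := by
  refine .of_eval fun a => ?_
  have hma : AEStronglyMeasurable (fun ω => y ω a) prob :=
    (continuous_apply a).comp_aestronglyMeasurable hm
  have hle (ω : Ω) : ‖y ω a‖ ^ 2 ≤ y ω ⬝ᵥ y ω := by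
    rw [Real.norm_eq_abs, sq_abs, sq]
    exact Finset.single_le_sum (f := fun b => y ω b * y ω b) (fun _ _ => mul_self_nonneg _)
      (Finset.mem_univ a)
  have hnorm : Integrable (fun ω => ‖y ω a‖ ^ (2 * j)) prob := by
    refine hy.mono' (hma.norm.pow _) (.of_forall fun ω => ?_)
    rw [Real.norm_of_nonneg (by positivity), pow_mul]
    exact pow_le_pow_left₀ (sq_nonneg _) (hle ω) j
  refine (integrable_norm_rpow_iff hma (by exact_mod_cast mul_ne_zero two_ne_zero hj)
    (ENNReal.natCast_ne_top _)).1 ?_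
  simpa only [ENNReal.toReal_natCast, Real.rpow_natCast] using hnorm

theorem integrable_dotProduct_of_indepFun {y z : Ω → ι → ℝ} (hyz : IndepFun y z prob)
    (hy : Integrable y prob) (hz : Integrable z prob) :
    Integrable (fun ω => y ω ⬝ᵥ z ω) prob :=
  integrable_finsetSum _ fun a _ =>
    (hyz.comp (measurable_pi_apply a) (measurable_pi_apply a)).integrable_mul (hy.eval a)
      (hz.eval a)

theorem integral_dotProduct_of_indepFun {y z : Ω → ι → ℝ} (hyz : IndepFun y z prob)
    (hy : Integrable y prob) (hz : Integrable z prob) :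
    ∫ ω, y ω ⬝ᵥ z ω ∂prob = ∫ ω, y ω ⬝ᵥ (fun a => ∫ ω', z ω' a ∂prob) ∂prob := by
  have hindep (a : ι) : IndepFun (fun ω => y ω a) (fun ω => z ω a) prob :=
    hyz.comp (measurable_pi_apply a) (measurable_pi_apply a)
  have hint (a : ι) : Integrable (fun ω => y ω a * z ω a) prob :=
    (hindep a).integrable_mul (hy.eval a) (hz.eval a)
  simp only [dotProduct]
  rw [integral_finsetSum _ fun a _ => hint a,
    integral_finsetSum _ fun a _ => (hy.eval a).mul_const _]
  refine Finset.sum_congr rfl fun a _ => ?_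
  rw [integral_mul_const]
  exact (hindep a).integral_mul_eq_mul_integral (hy.eval a).1 (hz.eval a).1

theorem noiseMean_eq_integral {ξ : Ω → Fin n → ℝ} (hξ : Integrable ξ prob) :
    noiseMean prob ξ = ∫ ω, ξ ω ∂prob :=
  funext fun a => (eval_integral hξ.eval a).symm

theorem noiseMean_mulVec (A : Matrix (Fin m) (Fin n) ℝ) {ξ : Ω → Fin n → ℝ}
    (hξ : Integrable ξ prob) :
    noiseMean prob (fun ω => A *ᵥ ξ ω) = A *ᵥ noiseMean prob ξ := by
  rw [noiseMean_eq_integral hξ]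
  exact (noiseMean_eq_integral (A.mulVecLin.toContinuousLinearMap.integrable_comp hξ)).trans
    (A.mulVecLin.toContinuousLinearMap.integral_comp_comm hξ)

theorem noiseMean_sub {ξ η : Ω → Fin n → ℝ} (hξ : Integrable ξ prob) (hη : Integrable η prob) :
    noiseMean prob (fun ω => ξ ω - η ω) = noiseMean prob ξ - noiseMean prob η :=
  funext fun a => integral_sub (hξ.eval a) (hη.eval a)

theorem noiseMean_const [IsProbabilityMeasure prob] (v : Fin n → ℝ) :
    noiseMean prob (fun _ => v) = v :=
  funext fun a => by simp only [noiseMean, integral_const, probReal_univ, one_smul]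

theorem noiseMean_sub_noiseMean [IsProbabilityMeasure prob] {ξ : Ω → Fin n → ℝ}
    (hξ : Integrable ξ prob) : noiseMean prob (fun ω => ξ ω - noiseMean prob ξ) = 0 := by
  rw [noiseMean_sub hξ (integrable_const _), noiseMean_const, sub_self]

theorem noiseMean_meanField {w : Ω → Fin k → Fin n → ℝ}
    (hw : ∀ i, Integrable (fun ω => w ω i) prob) :
    noiseMean prob (fun ω => meanField (w ω))
      = meanField fun i => noiseMean prob fun ω => w ω i := by
  funext a
  simp only [noiseMean, meanField, Pi.smul_apply, Finset.sum_apply, smul_eq_mul]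
  rw [integral_const_mul, integral_finsetSum _ fun i _ => (hw i).eval a]

end RandomVectors

section IndependentDisturbance

variable {n : ℕ} {Ω : Type*} {mΩ : MeasurableSpace Ω} {prob : Measure Ω}
  {M Q : Matrix (Fin n) (Fin n) ℝ} {y z ξ : Ω → Fin n → ℝ}

theorem integral_dotProduct_add [IsProbabilityMeasure prob] (v : Fin n → ℝ)
    (hy : Integrable y prob) (hξ : Integrable ξ prob) :
    ∫ ω, v ⬝ᵥ (y ω + ξ ω) ∂prob = ∫ ω, v ⬝ᵥ (y ω + noiseMean prob ξ) ∂prob := by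
  have hcomp {x : Ω → Fin n → ℝ} (hx : Integrable x prob) :
      ∫ ω, v ⬝ᵥ x ω ∂prob = v ⬝ᵥ ∫ ω, x ω ∂prob :=
    (dotProductBilin ℝ ℝ v).toContinuousLinearMap.integral_comp_comm hx
  rw [hcomp (hy.fun_add hξ), hcomp (hy.fun_add (integrable_const _)), integral_add hy hξ,
    integral_add hy (integrable_const _), noiseMean_eq_integral hξ, integral_const, probReal_univ,
    one_smul]

theorem integral_quad_add_of_indepFun [IsProbabilityMeasure prob] (hM : M.IsSymm)
    (hyξ : IndepFun y ξ prob) (hy : MemLp y 2 prob) (hξ : MemLp ξ 2 prob) :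
    ∫ ω, quad M (y ω + ξ ω) ∂prob = ∫ ω, quad M (y ω + noiseMean prob ξ) ∂prob
      + ∫ ω, quad M (ξ ω - noiseMean prob ξ) ∂prob := by
  set μ := noiseMean prob ξ
  have hξ1 : Integrable ξ prob := hξ.integrable one_le_two
  have hd : MemLp (fun ω => ξ ω - μ) 2 prob := hξ.sub (memLp_const μ)
  have hYμ : MemLp (fun ω => y ω + μ) 2 prob := hy.add (memLp_const μ)
  have hMd : MemLp (fun ω => M *ᵥ (ξ ω - μ)) 2 prob := memLp_mulVec M hd
  have hindep : IndepFun (fun ω => y ω + μ) (fun ω => M *ᵥ (ξ ω - μ)) prob :=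
    hyξ.comp (φ := fun x => x + μ) (ψ := fun x => M *ᵥ (x - μ)) (by fun_prop)
      (by fun_prop)
  have hcross : ∫ ω, (y ω + μ) ⬝ᵥ M *ᵥ (ξ ω - μ) ∂prob = 0 := by
    have hmean : noiseMean prob (fun ω => M *ᵥ (ξ ω - μ)) = 0 := by
      rw [noiseMean_mulVec M (hd.integrable one_le_two), noiseMean_sub_noiseMean hξ1,
        Matrix.mulVec_zero]
    have hfactor := integral_dotProduct_of_indepFun hindep (hYμ.integrable one_le_two)
      (hMd.integrable one_le_two)
    change _ = ∫ ω, (y ω + μ) ⬝ᵥ noiseMean prob (fun ω' => M *ᵥ (ξ ω' - μ)) ∂prob at hfactor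
    simpa only [hmean, dotProduct_zero, integral_zero] using hfactor
  have hexpand (ω : Ω) : quad M (y ω + ξ ω) = quad M (y ω + μ)
      + 2 * ((y ω + μ) ⬝ᵥ M *ᵥ (ξ ω - μ)) + quad M (ξ ω - μ) := by
    rw [← quad_add hM, add_add_sub_cancel]
  have hcross_int := (integrable_dotProduct hYμ hMd).const_mul 2
  simp only [hexpand]
  rw [integral_add ((integrable_quad hYμ M).fun_add hcross_int) (integrable_quad hd M),
    integral_add (integrable_quad hYμ M) hcross_int, integral_const_mul, hcross, mul_zero, add_zero]

theorem indepFun_tensor_centered (hzξ : IndepFun z ξ prob) :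
    IndepFun (fun ω (p : Fin n × Fin n) => z ω p.1 * z ω p.2)
      (fun ω (p : Fin n × Fin n) =>
        (ξ ω - noiseMean prob ξ) p.1 * (ξ ω - noiseMean prob ξ) p.2) prob :=
  hzξ.comp (φ := fun (x : Fin n → ℝ) (p : Fin n × Fin n) => x p.1 * x p.2)
    (ψ := fun (x : Fin n → ℝ) (p : Fin n × Fin n) =>
      (x - noiseMean prob ξ) p.1 * (x - noiseMean prob ξ) p.2)
    (by fun_prop) (by simp only [Pi.sub_apply]; fun_prop)

theorem integrable_tensor (hy : MemLp y 2 prob) :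
    Integrable (fun ω (p : Fin n × Fin n) => y ω p.1 * y ω p.2) prob :=
  .of_eval fun p => (hy.eval p.1).integrable_mul (hy.eval p.2)

theorem sq_dotProduct_eq_tensor (x d : Fin n → ℝ) :
    (x ⬝ᵥ d) ^ 2
      = (fun p : Fin n × Fin n => x p.1 * x p.2) ⬝ᵥ fun p => d p.1 * d p.2 := by
  rw [sq_dotProduct_eq_quad, quad_eq_dotProduct]
  rfl

theorem memLp_dotProduct_centered [IsFiniteMeasure prob] (hzξ : IndepFun z ξ prob)
    (hz : MemLp z 2 prob) (hξ : MemLp ξ 2 prob) :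
    MemLp (fun ω => z ω ⬝ᵥ (ξ ω - noiseMean prob ξ)) 2 prob := by
  have hd : MemLp (fun ω => ξ ω - noiseMean prob ξ) 2 prob := hξ.sub (memLp_const _)
  refine (memLp_two_iff_integrable_sq (integrable_dotProduct hz hd).1).2 ?_
  simp only [sq_dotProduct_eq_tensor]
  exact integrable_dotProduct_of_indepFun (indepFun_tensor_centered hzξ) (integrable_tensor hz)
    (integrable_tensor hd)

theorem integral_sq_dotProduct_centered [IsProbabilityMeasure prob] (hzξ : IndepFun z ξ prob)
    (hz : MemLp z 2 prob) (hξ : MemLp ξ 2 prob) :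
    ∫ ω, (z ω ⬝ᵥ (ξ ω - noiseMean prob ξ)) ^ 2 ∂prob
      = ∫ ω, quad (noiseCov prob ξ) (z ω) ∂prob := by
  have hd : MemLp (fun ω => ξ ω - noiseMean prob ξ) 2 prob := hξ.sub (memLp_const _)
  simp only [sq_dotProduct_eq_tensor, quad_eq_dotProduct]
  exact integral_dotProduct_of_indepFun (indepFun_tensor_centered hzξ) (integrable_tensor hz)
    (integrable_tensor hd)

theorem posSemidef_noiseCov [IsProbabilityMeasure prob] (hξ : MemLp ξ 2 prob) :
    (noiseCov prob ξ).PosSemidef := by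
  refine posSemidef_of_quad_nonneg (isSymm_noiseCov prob ξ) fun x => ?_
  have hvar := integral_sq_dotProduct_centered (indepFun_const_left x ξ) (memLp_const x) hξ
  rw [integral_const, probReal_univ, one_smul] at hvar
  exact hvar ▸ integral_nonneg fun _ => sq_nonneg _

theorem posSemidef_Qlam [IsProbabilityMeasure prob] {k m : ℕ} {D : Data k n m} {t : ℕ}
    (hlam : 0 ≤ D.lam) (hQ : (D.Q t).IsSymm) (hξ : MemLp ξ 2 prob) :
    (Qlam prob D ξ t).PosSemidef := by
  refine posSemidef_of_quad_nonneg (isSymm_Qlam prob ξ hQ) fun x => ?_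
  have hsandwich := quad_mulVec (noiseCov prob ξ) (D.Q t) x
  rw [hQ.eq] at hsandwich
  rw [Qlam, quad_smul_left, ← hsandwich]
  exact mul_nonneg (by positivity) (quad_nonneg (posSemidef_noiseCov hξ) _)

end IndependentDisturbance

section PredictionError

variable {n : ℕ} {Ω : Type*} {ℱ mΩ : MeasurableSpace Ω} {prob : Measure Ω}
  {Q : Matrix (Fin n) (Fin n) ℝ} {y z ξ : Ω → Fin n → ℝ}

instance holderTriple_four_four_two : ENNReal.HolderTriple 4 4 2 where
  inv_add_inv_eq_inv := by
    rw [← two_mul, show (4 : ENNReal) = 2 * 2 by norm_num,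
      ENNReal.mul_inv (.inl two_ne_zero) (.inl ENNReal.ofNat_ne_top), ← mul_assoc,
      ENNReal.mul_inv_cancel two_ne_zero ENNReal.ofNat_ne_top, one_mul]

/-- The centered energy `dᵀ Q d - E(dᵀ Q d)` of the centered disturbance `d = ξ - μ`. -/
noncomputable def centeredEnergy {_ : MeasurableSpace Ω} (prob : Measure Ω) (ξ : Ω → Fin n → ℝ)
    (Q : Matrix (Fin n) (Fin n) ℝ) (ω : Ω) : ℝ :=
  quad Q (ξ ω - noiseMean prob ξ) - ∫ ω', quad Q (ξ ω' - noiseMean prob ξ) ∂prob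

theorem memLp_centeredEnergy [IsFiniteMeasure prob] (hξ : MemLp ξ 4 prob)
    (Q : Matrix (Fin n) (Fin n) ℝ) : MemLp (centeredEnergy prob ξ Q) 2 prob := by
  have hd : MemLp (fun ω => ξ ω - noiseMean prob ξ) 4 prob := hξ.sub (memLp_const _)
  exact (memLp_quad hd Q).sub (memLp_const _)

variable [IsProbabilityMeasure prob]

theorem integral_centered_mul_centeredEnergy (hξ : MemLp ξ 4 prob)
    (Q : Matrix (Fin n) (Fin n) ℝ) :
    (fun a => ∫ ω, (ξ ω - noiseMean prob ξ) a * centeredEnergy prob ξ Q ω ∂prob)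
      = noiseSkew prob ξ Q := by
  have hd : MemLp (fun ω => ξ ω - noiseMean prob ξ) 4 prob := hξ.sub (memLp_const _)
  have hd2 := memLp_two_of_memLp_four hd
  have hmean := noiseMean_sub_noiseMean
    ((memLp_two_of_memLp_four hξ).integrable one_le_two)
  funext a
  have hint : Integrable (fun ω => (ξ ω - noiseMean prob ξ) a
      * quad Q (ξ ω - noiseMean prob ξ)) prob :=
    (hd2.eval a).integrable_mul (memLp_quad (r := 2) hd Q)
  have hzero : ∫ ω, (ξ ω - noiseMean prob ξ) a ∂prob = 0 := congrFun hmean a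
  simp only [centeredEnergy, mul_sub]
  rw [integral_sub hint (((hd2.eval a).integrable one_le_two).mul_const _), integral_mul_const,
    hzero, zero_mul, sub_zero, noiseSkew]

theorem integral_dotProduct_mul_centeredEnergy (hzξ : IndepFun z ξ prob) (hz : MemLp z 2 prob)
    (hξ : MemLp ξ 4 prob) (Q : Matrix (Fin n) (Fin n) ℝ) :
    ∫ ω, (z ω ⬝ᵥ (ξ ω - noiseMean prob ξ)) * centeredEnergy prob ξ Q ω ∂prob
      = ∫ ω, z ω ⬝ᵥ noiseSkew prob ξ Q ∂prob := by
  have hd : MemLp (fun ω => ξ ω - noiseMean prob ξ) 4 prob := hξ.sub (memLp_const _)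
  have hindep : IndepFun z
      (fun ω a => (ξ ω - noiseMean prob ξ) a * centeredEnergy prob ξ Q ω) prob := by
    refine hzξ.comp (φ := id) (ψ := fun x a => (x - noiseMean prob ξ) a
      * (quad Q (x - noiseMean prob ξ) - ∫ ω', quad Q (ξ ω' - noiseMean prob ξ) ∂prob))
      measurable_id ?_
    simp only [Pi.sub_apply]
    fun_prop
  have hint : Integrable
      (fun ω a => (ξ ω - noiseMean prob ξ) a * centeredEnergy prob ξ Q ω) prob :=
    .of_eval fun a =>
      ((memLp_two_of_memLp_four hd).eval a).integrable_mul (memLp_centeredEnergy hξ Q)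
  rw [← integral_centered_mul_centeredEnergy hξ Q,
    ← integral_dotProduct_of_indepFun hindep (hz.integrable one_le_two) hint]
  simp only [dotProduct, Finset.sum_mul, mul_assoc]

theorem integral_sq_dotProduct_add_centeredEnergy (hzξ : IndepFun z ξ prob)
    (hz : MemLp z 2 prob) (hξ : MemLp ξ 4 prob) (Q : Matrix (Fin n) (Fin n) ℝ) :
    ∫ ω, (2 * (z ω ⬝ᵥ (ξ ω - noiseMean prob ξ)) + centeredEnergy prob ξ Q ω) ^ 2 ∂prob
      = 4 * ∫ ω, quad (noiseCov prob ξ) (z ω) ∂prob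
        + 4 * ∫ ω, z ω ⬝ᵥ noiseSkew prob ξ Q ∂prob
        + ∫ ω, centeredEnergy prob ξ Q ω ^ 2 ∂prob := by
  have hξ2 := memLp_two_of_memLp_four hξ
  have hzd := memLp_dotProduct_centered hzξ hz hξ2
  have hη := memLp_centeredEnergy hξ Q
  have hexpand (ω : Ω) : (2 * (z ω ⬝ᵥ (ξ ω - noiseMean prob ξ)) + centeredEnergy prob ξ Q ω) ^ 2
      = 4 * (z ω ⬝ᵥ (ξ ω - noiseMean prob ξ)) ^ 2
        + 4 * ((z ω ⬝ᵥ (ξ ω - noiseMean prob ξ)) * centeredEnergy prob ξ Q ω)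
        + centeredEnergy prob ξ Q ω ^ 2 := by ring
  have hsq := hzd.integrable_sq.const_mul 4
  have hmix : Integrable (fun ω =>
      4 * ((z ω ⬝ᵥ (ξ ω - noiseMean prob ξ)) * centeredEnergy prob ξ Q ω)) prob :=
    (hzd.integrable_mul hη).const_mul 4
  simp only [hexpand]
  rw [integral_add (hsq.fun_add hmix) hη.integrable_sq, integral_add hsq hmix, integral_const_mul,
    integral_const_mul, integral_sq_dotProduct_centered hzξ hz hξ2,
    integral_dotProduct_mul_centeredEnergy hzξ hz hξ]

theorem condExp_dotProduct_of_indep (hℱ : ℱ ≤ mΩ) (hξ : Measurable ξ)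
    (hindep : Indep (MeasurableSpace.comap ξ inferInstance) ℱ prob) (hz : Measurable[ℱ] z)
    (hint : Integrable (fun ω => z ω ⬝ᵥ ξ ω) prob) (hξ1 : Integrable ξ prob) :
    prob[fun ω => z ω ⬝ᵥ ξ ω | ℱ] =ᵐ[prob] fun ω => z ω ⬝ᵥ noiseMean prob ξ := by
  have hpull := condExp_bilin_of_stronglyMeasurable_left
    (dotProductBilin ℝ ℝ).toContinuousBilinearMap hz.stronglyMeasurable hint hξ1
  have hmean := condExp_indep_eq hξ.comap_le hℱ (comap_measurable ξ).stronglyMeasurable hindep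
  filter_upwards [hpull, hmean] with ω hω hωmean
  rw [hωmean, ← noiseMean_eq_integral hξ1] at hω
  exact hω

end PredictionError

section PredictionErrorMoments

variable {n : ℕ} {Ω : Type*} {ℱ mΩ : MeasurableSpace Ω} {prob : Measure Ω}
  [IsProbabilityMeasure prob] {Q : Matrix (Fin n) (Fin n) ℝ} {y ξ : Ω → Fin n → ℝ}

theorem condExp_quad_add_of_indep (hℱ : ℱ ≤ mΩ) (hQ : Q.IsSymm) (hξm : Measurable ξ)
    (hindep : Indep (MeasurableSpace.comap ξ inferInstance) ℱ prob) (hym : Measurable[ℱ] y)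
    (hy : MemLp y 2 prob) (hξ : MemLp ξ 2 prob) :
    prob[fun ω => quad Q (y ω + ξ ω) | ℱ] =ᵐ[prob] fun ω => quad Q (y ω + noiseMean prob ξ)
      + ∫ ω', quad Q (ξ ω' - noiseMean prob ξ) ∂prob := by
  set μ := noiseMean prob ξ
  set d : Ω → Fin n → ℝ := fun ω => ξ ω - μ
  set z : Ω → Fin n → ℝ := fun ω => (2 : ℝ) • Q *ᵥ (y ω + μ)
  have hd : MemLp d 2 prob := hξ.sub (memLp_const μ)
  have hdm : Measurable d := hξm.sub_const μ
  have hdℱ : Indep (MeasurableSpace.comap d inferInstance) ℱ prob :=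
    indep_of_indep_of_le_left hindep ((comap_measurable ξ).sub_const μ).comap_le
  have hyμ : MemLp (fun ω => y ω + μ) 2 prob := hy.add (memLp_const μ)
  have hyμm : Measurable[ℱ] fun ω => y ω + μ := hym.add_const μ
  have hz : MemLp z 2 prob := (memLp_mulVec Q hyμ).const_smul (2 : ℝ)
  have hzm : Measurable[ℱ] z := ((measurable_mulVec Q).comp hyμm).const_smul (2 : ℝ)
  have hexpand : (fun ω => quad Q (y ω + ξ ω))
      = (fun ω => quad Q (y ω + μ)) + (fun ω => z ω ⬝ᵥ d ω) + fun ω => quad Q (d ω) := by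
    funext ω
    rw [← add_add_sub_cancel (y ω) (ξ ω) μ, quad_add hQ]
    simp only [z, d, Pi.add_apply, smul_dotProduct, mulVec_dotProduct hQ,
      smul_eq_mul]
  have hpastInt := integrable_quad hyμ Q
  have hcrossInt := integrable_dotProduct hz hd
  have hpast : prob[fun ω => quad Q (y ω + μ) | ℱ] = fun ω => quad Q (y ω + μ) :=
    condExp_of_stronglyMeasurable hℱ ((measurable_quad Q).comp hyμm).stronglyMeasurable hpastInt
  have hcross : prob[fun ω => z ω ⬝ᵥ d ω | ℱ] =ᵐ[prob] fun ω => z ω ⬝ᵥ noiseMean prob d :=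
    condExp_dotProduct_of_indep hℱ hdm hdℱ hzm hcrossInt (hd.integrable one_le_two)
  have henergy : prob[fun ω => quad Q (d ω) | ℱ] =ᵐ[prob] fun _ => ∫ ω, quad Q (d ω) ∂prob :=
    condExp_indep_eq hdm.comap_le hℱ
      ((measurable_quad Q).comp (comap_measurable d)).stronglyMeasurable hdℱ
  have hmean : noiseMean prob d = 0 := noiseMean_sub_noiseMean (hξ.integrable one_le_two)
  rw [hexpand]
  filter_upwards [condExp_add (hpastInt.add hcrossInt) (integrable_quad hd Q) ℱ,
    condExp_add hpastInt hcrossInt ℱ, hcross, henergy] with ω hsum hsum' hcrossω henergyω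
  rw [hsum, Pi.add_apply, hsum', Pi.add_apply, hcrossω, henergyω, hpast, hmean, dotProduct_zero,
    add_zero]

theorem quad_add_sub_condExp_ae_eq (hℱ : ℱ ≤ mΩ) (hQ : Q.IsSymm) (hξm : Measurable ξ)
    (hindep : Indep (MeasurableSpace.comap ξ inferInstance) ℱ prob) (hym : Measurable[ℱ] y)
    (hy : MemLp y 2 prob) (hξ : MemLp ξ 2 prob) :
    (fun ω => quad Q (y ω + ξ ω) - (prob[fun ω' => quad Q (y ω' + ξ ω') | ℱ]) ω)
      =ᵐ[prob] fun ω => 2 * ((Q *ᵥ (y ω + noiseMean prob ξ)) ⬝ᵥ (ξ ω - noiseMean prob ξ))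
        + centeredEnergy prob ξ Q ω := by
  filter_upwards [condExp_quad_add_of_indep hℱ hQ hξm hindep hym hy hξ] with ω hω
  rw [hω, ← add_add_sub_cancel (y ω) (ξ ω) (noiseMean prob ξ), quad_add hQ, mulVec_dotProduct hQ,
    centeredEnergy]
  ring

theorem memLp_quad_add_sub_condExp (hℱ : ℱ ≤ mΩ) (hQ : Q.IsSymm) (hξm : Measurable ξ)
    (hindep : Indep (MeasurableSpace.comap ξ inferInstance) ℱ prob) (hym : Measurable[ℱ] y)
    (hy : MemLp y 2 prob) (hξ : MemLp ξ 4 prob) :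
    MemLp (fun ω => quad Q (y ω + ξ ω) - (prob[fun ω' => quad Q (y ω' + ξ ω') | ℱ]) ω) 2 prob := by
  have hξ2 := memLp_two_of_memLp_four hξ
  have hzξ : IndepFun (fun ω => Q *ᵥ (y ω + noiseMean prob ξ)) ξ prob :=
    (indep_of_indep_of_le_right hindep
      ((measurable_mulVec Q).comp (hym.add_const _)).comap_le).symm
  have hz : MemLp (fun ω => Q *ᵥ (y ω + noiseMean prob ξ)) 2 prob :=
    memLp_mulVec Q (hy.add (memLp_const _))
  exact (memLp_congr_ae (quad_add_sub_condExp_ae_eq hℱ hQ hξm hindep hym hy hξ2)).2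
    (((memLp_dotProduct_centered hzξ hz hξ2).const_mul 2).add (memLp_centeredEnergy hξ Q))

theorem integral_sq_quad_add_sub_condExp (hℱ : ℱ ≤ mΩ) (hQ : Q.IsSymm) (hξm : Measurable ξ)
    (hindep : Indep (MeasurableSpace.comap ξ inferInstance) ℱ prob) (hym : Measurable[ℱ] y)
    (hy : MemLp y 2 prob) (hξ : MemLp ξ 4 prob) :
    ∫ ω, (quad Q (y ω + ξ ω) - (prob[fun ω' => quad Q (y ω' + ξ ω') | ℱ]) ω) ^ 2 ∂prob
      = 4 * ∫ ω, quad (Q * noiseCov prob ξ * Q) (y ω + ξ ω) ∂prob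
        + 4 * ∫ ω, (Q *ᵥ noiseSkew prob ξ Q) ⬝ᵥ (y ω + ξ ω) ∂prob
        + (∫ ω, centeredEnergy prob ξ Q ω ^ 2 ∂prob
          - 4 * ∫ ω, quad (Q * noiseCov prob ξ * Q) (ξ ω - noiseMean prob ξ) ∂prob) := by
  have hξ2 := memLp_two_of_memLp_four hξ
  have hyξ : IndepFun y ξ prob := (indep_of_indep_of_le_right hindep hym.comap_le).symm
  have hswap (x v : Fin n → ℝ) : (Q *ᵥ x) ⬝ᵥ v = (Q *ᵥ v) ⬝ᵥ x := by
    rw [mulVec_dotProduct hQ, dotProduct_comm]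
  have hz : MemLp (fun ω => Q *ᵥ (y ω + noiseMean prob ξ)) 2 prob :=
    memLp_mulVec Q (hy.add (memLp_const _))
  have hzξ : IndepFun (fun ω => Q *ᵥ (y ω + noiseMean prob ξ)) ξ prob :=
    hyξ.comp (φ := fun x => Q *ᵥ (x + noiseMean prob ξ)) (by fun_prop) measurable_id
  have hsymm : (Q * noiseCov prob ξ * Q).IsSymm := by
    simpa only [hQ.eq] using isSymm_transpose_mul_mul (isSymm_noiseCov prob ξ) Q
  have herror := (quad_add_sub_condExp_ae_eq hℱ hQ hξm hindep hym hy hξ2).fun_comp (· ^ 2)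
  calc
    _ = ∫ ω, (2 * ((Q *ᵥ (y ω + noiseMean prob ξ)) ⬝ᵥ (ξ ω - noiseMean prob ξ))
          + centeredEnergy prob ξ Q ω) ^ 2 ∂prob := integral_congr_ae herror
    _ = 4 * ∫ ω, quad (Q * noiseCov prob ξ * Q) (y ω + noiseMean prob ξ) ∂prob
        + 4 * ∫ ω, (Q *ᵥ noiseSkew prob ξ Q) ⬝ᵥ (y ω + noiseMean prob ξ) ∂prob
        + ∫ ω, centeredEnergy prob ξ Q ω ^ 2 ∂prob := by
      rw [integral_sq_dotProduct_add_centeredEnergy hzξ hz hξ]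
      simp only [quad_mulVec, hQ.eq, hswap _ (noiseSkew prob ξ Q)]
    _ = _ := by
      rw [integral_quad_add_of_indepFun hsymm hyξ hy hξ2,
        integral_dotProduct_add _ (hy.integrable one_le_two) (hξ2.integrable one_le_two)]
      ring

end PredictionErrorMoments

section DriftMoments

variable {k n m : ℕ} {Ω : Type*}

theorem measurable_drift {_ : MeasurableSpace Ω} {x : Ω → Fin k → Fin n → ℝ}
    {v : Ω → Fin k → Fin m → ℝ} (D : Data k n m) (t : ℕ) (hx : Measurable x) (hv : Measurable v) :
    Measurable fun ω => drift D t (x ω) (v ω) :=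
  measurable_pi_lambda _ fun i =>
    (((measurable_mulVec _).comp ((measurable_pi_apply i).comp hx)).add
      ((measurable_mulVec _).comp ((measurable_pi_apply i).comp hv))).add
      ((measurable_mulVec _).comp (measurable_meanField.comp hx))

theorem memLp_drift {_ : MeasurableSpace Ω} {prob : Measure Ω} {p : ENNReal}
    {x : Ω → Fin k → Fin n → ℝ} {v : Ω → Fin k → Fin m → ℝ} (D : Data k n m) (t : ℕ)
    (hx : MemLp x p prob) (hv : MemLp v p prob) :
    MemLp (fun ω => drift D t (x ω) (v ω)) p prob :=
  .of_eval fun i => ((memLp_mulVec _ (hx.eval i)).add (memLp_mulVec _ (hv.eval i))).add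
    (memLp_mulVec _ (memLp_meanField hx))

end DriftMoments

section MeanFieldDisturbance

variable {k n m : ℕ} {Ω : Type*} [MeasurableSpace Ω] {prob : Measure Ω} {D : Data k n m}
  {ξ : Ω → Fin n → ℝ} {t : ℕ}

theorem integrable_stateCost {x : Ω → Fin k → Fin n → ℝ} (D : Data k n m) (t : ℕ)
    (hx : MemLp x 2 prob) : Integrable (fun ω => stateCost D t (x ω)) prob :=
  integrable_finsetSum _ fun i _ =>
    (integrable_quad (memLp_meanField hx) _).add (integrable_quad (hx.eval i) _)

theorem integrable_controlCost {u : Ω → Fin k → Fin m → ℝ} (D : Data k n m) (t : ℕ)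
    (hu : MemLp u 2 prob) : Integrable (fun ω => controlCost D t (u ω)) prob :=
  integrable_finsetSum _ fun i _ => integrable_quad (hu.eval i) _

theorem memLp_sub_meanField {x : Ω → Fin k → Fin n → ℝ} (hx : MemLp x 2 prob) (i : Fin k) :
    MemLp (fun ω => x ω i - meanField (x ω)) 2 prob :=
  (hx.eval i).sub (memLp_meanField hx)

theorem integrable_riskAdjustment [IsFiniteMeasure prob] {x : Ω → Fin k → Fin n → ℝ}
    (D : Data k n m) (ξ : Ω → Fin n → ℝ) (t : ℕ) (hx : MemLp x 2 prob) :
    Integrable (fun ω => riskAdjustment prob D ξ t (x ω)) prob :=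
  integrable_finsetSum _ fun i _ => (integrable_quad (hx.eval i) _).add
    (integrable_dotProduct (memLp_const _) (hx.eval i))

theorem integral_riskAdjustment [IsFiniteMeasure prob] {x : Ω → Fin k → Fin n → ℝ} (D : Data k n m)
    (ξ : Ω → Fin n → ℝ) (t : ℕ) (hx : MemLp x 2 prob) :
    ∫ ω, riskAdjustment prob D ξ t (x ω) ∂prob
      = D.lam * ∑ i, (4 * ∫ ω, quad (D.Q t * noiseCov prob ξ * D.Q t) (x ω i) ∂prob
        + 4 * ∫ ω, (D.Q t *ᵥ noiseSkew prob ξ (D.Q t)) ⬝ᵥ x ω i ∂prob) := by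
  have hquad (i : Fin k) := integrable_quad (hx.eval i) (Qlam prob D ξ t)
  have hlin (i : Fin k) := integrable_dotProduct (memLp_const (blam prob D ξ t)) (hx.eval i)
  simp only [riskAdjustment]
  rw [integral_finsetSum _ fun i _ => (hquad i).fun_add (hlin i), Finset.mul_sum]
  refine Finset.sum_congr rfl fun i _ => ?_
  rw [integral_add (hquad i) (hlin i)]
  simp only [Qlam, blam, quad_smul_left, smul_dotProduct, smul_eq_mul, integral_const_mul]
  ring

theorem integrable_value [IsFiniteMeasure prob] {x : Ω → Fin k → Fin n → ℝ} (D : Data k n m)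
    (ξ : Ω → Fin n → ℝ) (t : ℕ) (hx : MemLp x 2 prob) :
    Integrable (fun ω => value prob D ξ t (x ω)) prob :=
  (integrable_finsetSum _ fun i _ => integrable_quad (memLp_sub_meanField hx i) _).add
    (((integrable_quad (memLp_meanField hx) _).add
      (integrable_dotProduct (memLp_const _) (memLp_meanField hx))).const_mul _)

theorem integrable_gap [IsFiniteMeasure prob] {x : Ω → Fin k → Fin n → ℝ}
    {u : Ω → Fin k → Fin m → ℝ} (D : Data k n m) (ξ : Ω → Fin n → ℝ) (t : ℕ)
    (hx : MemLp x 2 prob) (hu : MemLp u 2 prob) :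
    Integrable (fun ω => gap prob D ξ t (x ω) (u ω)) prob :=
  (integrable_finsetSum _ fun i _ => integrable_quad ((memLp_sub_meanField hu i).sub
    (memLp_mulVec _ (memLp_sub_meanField hx i))) _).add
    ((integrable_quad ((memLp_meanField hu).sub
      ((memLp_mulVec _ (memLp_meanField hx)).add (memLp_const _))) _).const_mul _)

theorem integral_value [IsFiniteMeasure prob] {x : Ω → Fin k → Fin n → ℝ} (D : Data k n m)
    (ξ : Ω → Fin n → ℝ) (t : ℕ) (hx : MemLp x 2 prob) :
    ∫ ω, value prob D ξ t (x ω) ∂prob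
      = ∑ i, ∫ ω, quad (S prob D ξ t) (x ω i - meanField (x ω)) ∂prob
        + k * (∫ ω, quad (Sbar prob D ξ t) (meanField (x ω)) ∂prob
          + ∫ ω, g prob D ξ t ⬝ᵥ meanField (x ω) ∂prob) := by
  have hdev (i : Fin k) := integrable_quad (memLp_sub_meanField hx i) (S prob D ξ t)
  have hquad := integrable_quad (memLp_meanField hx) (Sbar prob D ξ t)
  have hlin := integrable_dotProduct (memLp_const (g prob D ξ t)) (memLp_meanField hx)
  simp only [value]
  rw [integral_add (integrable_finsetSum _ fun i _ => hdev i) ((hquad.fun_add hlin).const_mul _),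
    integral_finsetSum _ fun i _ => hdev i, integral_const_mul, integral_add hquad hlin]

theorem exists_integral_dynamic_programming [NeZero k] [IsProbabilityMeasure prob]
    (h : RiccatiRegular prob D ξ) (ht : t < D.T) :
    ∃ c, ∀ (x : Ω → Fin k → Fin n → ℝ) (u : Ω → Fin k → Fin m → ℝ),
      MemLp x 2 prob → MemLp u 2 prob →
      ∫ ω, stateCost D t (x ω) ∂prob + ∫ ω, riskAdjustment prob D ξ t (x ω) ∂prob
          + ∫ ω, controlCost D t (u ω) ∂prob
          + ∫ ω, value prob D ξ (t + 1) (drift D t (x ω) (u ω) + fun _ => noiseMean prob ξ) ∂prob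
        = ∫ ω, value prob D ξ t (x ω) ∂prob + ∫ ω, gap prob D ξ t (x ω) (u ω) ∂prob + c := by
  obtain ⟨c, hc⟩ := dynamic_programming h ht
  refine ⟨c, fun x u hx hu => ?_⟩
  have hstate := integrable_stateCost D t hx
  have hrisk := integrable_riskAdjustment D ξ t hx
  have hcontrol := integrable_controlCost D t hu
  have hnext : Integrable (fun ω => value prob D ξ (t + 1)
      (drift D t (x ω) (u ω) + fun _ => noiseMean prob ξ)) prob := integrable_value D ξ (t + 1)
    ((memLp_drift D t hx hu).add (memLp_const fun _ => noiseMean prob ξ))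
  have hvalue := integrable_value D ξ t hx
  have hgap := integrable_gap D ξ t hx hu
  have hintegral := integral_congr_ae (μ := prob) (.of_forall fun ω => hc (x ω) (u ω))
  rw [integral_add ((hstate.fun_add hrisk).fun_add hcontrol) hnext,
    integral_add (hstate.fun_add hrisk) hcontrol, integral_add hstate hrisk,
    integral_add (hvalue.fun_add hgap) (integrable_const c), integral_add hvalue hgap,
    integral_const, probReal_univ, one_smul] at hintegral
  exact hintegral

theorem integral_value_add [NeZero k] [IsProbabilityMeasure prob] (h : RiccatiRegular prob D ξ)
    (ht : t ≤ D.T) {y η : Ω → Fin k → Fin n → ℝ} (hyη : IndepFun y η prob)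
    (hy : MemLp y 2 prob) (hη : MemLp η 2 prob) {μ : Fin n → ℝ}
    (hmean : ∀ i, noiseMean prob (fun ω => η ω i) = μ) :
    ∫ ω, value prob D ξ t (y ω + η ω) ∂prob
      = ∫ ω, value prob D ξ t (y ω + fun _ => μ) ∂prob
        + (∑ i, ∫ ω, quad (S prob D ξ t) (η ω i - meanField (η ω)) ∂prob
          + k * ∫ ω, quad (Sbar prob D ξ t) (meanField (η ω) - μ) ∂prob) := by
  have hη1 (i : Fin k) : Integrable (fun ω => η ω i) prob := (hη.eval i).integrable one_le_two
  have hmean_bar : noiseMean prob (fun ω => meanField (η ω)) = μ := by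
    rw [noiseMean_meanField hη1, funext hmean, meanField_const]
  have hmean_dev (i : Fin k) : noiseMean prob (fun ω => η ω i - meanField (η ω)) = 0 := by
    rw [noiseMean_sub (hη1 i) ((memLp_meanField hη).integrable one_le_two), hmean, hmean_bar,
      sub_self]
  have hdev_meas (i : Fin k) : Measurable fun x : Fin k → Fin n → ℝ => x i - meanField x :=
    (measurable_pi_apply i).sub measurable_meanField
  have hdev (i : Fin k) := integral_quad_add_of_indepFun (h.isSymm_S ht)
    (hyη.comp (hdev_meas i) (hdev_meas i)) (memLp_sub_meanField hy i) (memLp_sub_meanField hη i)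
  have hbar := integral_quad_add_of_indepFun (h.isSymm_Sbar ht)
    (hyη.comp measurable_meanField measurable_meanField) (memLp_meanField hy) (memLp_meanField hη)
  have hlin := integral_dotProduct_add (g prob D ξ t)
    ((memLp_meanField hy).integrable one_le_two) ((memLp_meanField hη).integrable one_le_two)
  simp only [Function.comp_def, hmean_dev, hmean_bar, add_zero, sub_zero] at hdev hbar hlin
  have hvalue := integral_value D ξ t (hy.add hη)
  have hvalue_mean := integral_value D ξ t (hy.add (memLp_const fun _ => μ))
  simp only [Pi.add_apply, meanField_add, meanField_const, add_sub_add_comm (_ : Fin n → ℝ),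
    sub_self, add_zero, hdev, hbar, hlin, Finset.sum_add_distrib] at hvalue hvalue_mean
  rw [hvalue, hvalue_mean]
  ring

end MeanFieldDisturbance

section Drift

variable {k n m : ℕ} {Ω : Type*} {D : Data k n m} {w : ℕ → Ω → Fin k → Fin n → ℝ}
  {u : ℕ → Ω → Fin k → Fin m → ℝ}

theorem state_succ (D : Data k n m) (w : ℕ → Ω → Fin k → Fin n → ℝ)
    (u : ℕ → Ω → Fin k → Fin m → ℝ) (t : ℕ) (ω : Ω) :
    state D w u (t + 1) ω = drift D t (state D w u t ω) (u t ω) + w (t + 1) ω :=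
  rfl

theorem memLp_state {mΩ : MeasurableSpace Ω} {prob : Measure Ω} [IsFiniteMeasure prob]
    {p : ENNReal} {t : ℕ} (hw : ∀ s < t, MemLp (w (s + 1)) p prob)
    (hu : ∀ s < t, MemLp (u s) p prob) : MemLp (state D w u t) p prob := by
  induction t with
  | zero => exact memLp_const D.x0
  | succ t ih =>
    have hx := ih (fun s hs => hw s (Nat.lt_succ_of_lt hs)) fun s hs => hu s (Nat.lt_succ_of_lt hs)
    exact (memLp_drift D t hx (hu t t.lt_succ_self)).add (hw t t.lt_succ_self)

end Drift

section Information

variable {k n m T : ℕ} {Ω : Type*} {D : Data k n m} {w : ℕ → Ω → Fin k → Fin n → ℝ}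
  {u : ℕ → Ω → Fin k → Fin m → ℝ} {s t : ℕ}

theorem measurable_state_histSigma (h : s ≤ t) : Measurable[histSigma D w u t] (state D w u s) :=
  (measurable_pi_apply (⟨s, Nat.lt_succ_of_le h⟩ : Fin (t + 1))).comp
    (measurable_fst.comp (comap_measurable (history D w u t)))

theorem histSigma_le_of_measurable {ℱ : MeasurableSpace Ω}
    (hx : ∀ s ≤ t, Measurable[ℱ] (state D w u s)) (hu : ∀ s < t, Measurable[ℱ] (u s)) :
    histSigma D w u t ≤ ℱ :=
  Measurable.comap_le (Measurable.prodMk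
    (measurable_pi_lambda _ fun s => hx s (Nat.le_of_lt_succ s.2))
    (measurable_pi_lambda _ fun s => hu s s.2))

/-- The σ-algebra generated by the disturbances `w₁, …, w_t` for `t ≤ T`. The index type `Fin T` is
the one over which the disturbances are independent. -/
@[reducible] def noiseSigma (T : ℕ) (w : ℕ → Ω → Fin k → Fin n → ℝ) (t : ℕ) : MeasurableSpace Ω :=
  ⨆ s ∈ {s : Fin T | (s : ℕ) < t}, MeasurableSpace.comap (w (s + 1)) inferInstance

theorem noiseSigma_mono (T : ℕ) (w : ℕ → Ω → Fin k → Fin n → ℝ) : Monotone (noiseSigma T w) :=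
  fun _ _ h => biSup_mono fun _ hs => lt_of_lt_of_le hs h

theorem measurable_noiseSigma_succ (ht : t < T) : Measurable[noiseSigma T w (t + 1)] (w (t + 1)) :=
  (comap_measurable (w (t + 1))).mono (le_biSup (f := fun s : Fin T =>
    MeasurableSpace.comap (w (s + 1)) inferInstance) (i := ⟨t, ht⟩) (Nat.lt_succ_self t)) le_rfl

variable [mΩ : MeasurableSpace Ω] {prob : Measure Ω}

namespace Admissible

theorem measurable_control (hu : Admissible prob D w u) (ht : t < D.T) :
    Measurable[histSigma D w u t] (u t) :=
  (@measurable_pi_iff _ _ _ (histSigma D w u t) _ _).2 fun i => (hu t ht i).1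

theorem measurable_noiseSigma (hu : Admissible prob D w u) (ht : t ≤ D.T) :
    (∀ s ≤ t, Measurable[noiseSigma D.T w t] (state D w u s)) ∧
      ∀ s < t, Measurable[noiseSigma D.T w t] (u s) := by
  induction t with
  | zero =>
    refine ⟨fun s hs => ?_, fun s hs => absurd hs (Nat.not_lt_zero s)⟩
    obtain rfl := Nat.le_zero.1 hs
    exact measurable_const
  | succ t ih =>
    obtain ⟨hx, hv⟩ := ih (Nat.le_of_succ_le ht)
    have hle := noiseSigma_mono D.T w t.le_succ
    have hut : Measurable[noiseSigma D.T w (t + 1)] (u t) :=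
      (hu.measurable_control ht).mono ((histSigma_le_of_measurable hx hv).trans hle) le_rfl
    have hxt : Measurable[noiseSigma D.T w (t + 1)] (state D w u t) := (hx t le_rfl).mono hle le_rfl
    refine ⟨fun s hs => ?_, fun s hs => ?_⟩
    · rcases Nat.le_succ_iff.1 hs with hs | rfl
      · exact (hx s hs).mono hle le_rfl
      · exact (measurable_drift D t hxt hut).add (measurable_noiseSigma_succ ht)
    · rcases Nat.lt_succ_iff_lt_or_eq.1 hs with hs | rfl
      · exact (hv s hs).mono hle le_rfl
      · exact hut

theorem histSigma_le_noiseSigma (hu : Admissible prob D w u) (ht : t ≤ D.T) :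
    histSigma D w u t ≤ noiseSigma D.T w t :=
  histSigma_le_of_measurable (hu.measurable_noiseSigma ht).1 (hu.measurable_noiseSigma ht).2

theorem histSigma_le (hu : Admissible prob D w u) (hw : ∀ t < D.T, Measurable (w (t + 1)))
    (ht : t ≤ D.T) : histSigma D w u t ≤ mΩ :=
  (hu.histSigma_le_noiseSigma ht).trans (iSup₂_le fun s _ => (hw s s.2).comap_le)

theorem indep_noise_histSigma (hu : Admissible prob D w u)
    (hw : ∀ t < D.T, Measurable (w (t + 1)))
    (hindep : iIndepFun (fun t : Fin D.T => w (t + 1)) prob) (ht : t < D.T) :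
    Indep (MeasurableSpace.comap (w (t + 1)) inferInstance) (histSigma D w u t) prob := by
  have hpast := indep_iSup_of_disjoint (fun s : Fin D.T => (hw s s.2).comap_le) hindep.iIndep
    (S := {⟨t, ht⟩}) (T := {s : Fin D.T | (s : ℕ) < t})
    (Set.disjoint_singleton_left.2 (lt_irrefl t))
  rw [iSup_singleton] at hpast
  exact indep_of_indep_of_le_right hpast (hu.histSigma_le_noiseSigma ht.le)

theorem measurable_drift (hu : Admissible prob D w u) (ht : t < D.T) :
    Measurable[histSigma D w u t] fun ω => drift D t (state D w u t ω) (u t ω) :=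
  MeanFieldLQ.measurable_drift D t (measurable_state_histSigma le_rfl) (hu.measurable_control ht)

theorem memLp_control (hu : Admissible prob D w u) (hw : ∀ t < D.T, Measurable (w (t + 1)))
    (ht : t < D.T) : MemLp (u t) 2 prob := by
  refine .of_eval fun i => ?_
  have hmeas : Measurable fun ω => u t ω i := (hu t ht i).1.mono (hu.histSigma_le hw ht.le) le_rfl
  simpa using memLp_of_integrable_dotProduct_self_pow one_ne_zero hmeas.aestronglyMeasurable
    (by simpa only [pow_one] using (hu t ht i).2)

end Admissible

end Information

section ClosedLoop

variable {k n m : ℕ} {Ω : Type*} {D : Data k n m} {w : ℕ → Ω → Fin k → Fin n → ℝ}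
  {u : ℕ → Ω → Fin k → Fin m → ℝ} {φ : ℕ → (Fin k → Fin n → ℝ) → Fin k → Fin m → ℝ} {t : ℕ}

/-- The state process when the controls are given by the Markov policy `φ`. -/
noncomputable def closedLoopState (D : Data k n m) (w : ℕ → Ω → Fin k → Fin n → ℝ)
    (φ : ℕ → (Fin k → Fin n → ℝ) → Fin k → Fin m → ℝ) : ℕ → Ω → Fin k → Fin n → ℝ
  | 0 => fun _ => D.x0
  | t + 1 => fun ω => drift D t (closedLoopState D w φ t ω) (φ t (closedLoopState D w φ t ω))
      + w (t + 1) ω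

/-- The control process generated by the Markov policy `φ`. -/
noncomputable def closedLoopControl (D : Data k n m) (w : ℕ → Ω → Fin k → Fin n → ℝ)
    (φ : ℕ → (Fin k → Fin n → ℝ) → Fin k → Fin m → ℝ) : ℕ → Ω → Fin k → Fin m → ℝ :=
  fun t ω => φ t (closedLoopState D w φ t ω)

theorem state_closedLoopControl (D : Data k n m) (w : ℕ → Ω → Fin k → Fin n → ℝ)
    (φ : ℕ → (Fin k → Fin n → ℝ) → Fin k → Fin m → ℝ) (t : ℕ) :
    state D w (closedLoopControl D w φ) t = closedLoopState D w φ t := by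
  induction t with
  | zero => rfl
  | succ t ih =>
    funext ω
    rw [state_succ, ih]
    rfl

variable [MeasurableSpace Ω] {prob : Measure Ω}

theorem ae_eq_closedLoopState (h : ∀ t < D.T, ∀ᵐ ω ∂prob, u t ω = φ t (state D w u t ω))
    (ht : t ≤ D.T) : ∀ᵐ ω ∂prob, state D w u t ω = closedLoopState D w φ t ω := by
  induction t with
  | zero => exact .of_forall fun _ => rfl
  | succ t ih =>
    filter_upwards [ih (Nat.le_of_succ_le ht), h t ht] with ω hx hu
    rw [state_succ, hu, hx, closedLoopState]

theorem ae_eq_closedLoopControl (h : ∀ t < D.T, ∀ᵐ ω ∂prob, u t ω = φ t (state D w u t ω))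
    (ht : t < D.T) : ∀ᵐ ω ∂prob, u t ω = closedLoopControl D w φ t ω := by
  filter_upwards [h t ht, ae_eq_closedLoopState h ht.le] with ω hu hx
  rw [hu, hx, closedLoopControl]

theorem memLp_closedLoopControl [IsFiniteMeasure prob] {p : ENNReal}
    (hw : ∀ t < D.T, MemLp (w (t + 1)) p prob)
    (hφ : ∀ t, ∀ x : Ω → Fin k → Fin n → ℝ, MemLp x p prob → MemLp (fun ω => φ t (x ω)) p prob)
    (ht : t < D.T) : MemLp (closedLoopControl D w φ t) p prob := by
  induction t using Nat.strong_induction_on with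
  | _ t ih =>
    have hx := memLp_state (D := D) (fun s hs => hw s (hs.trans ht))
      fun s hs => ih s hs (hs.trans ht)
    rw [state_closedLoopControl] at hx
    exact hφ t _ hx

theorem admissible_closedLoopControl [IsFiniteMeasure prob]
    (hw : ∀ t < D.T, MemLp (w (t + 1)) 2 prob) (hφm : ∀ t, Measurable (φ t))
    (hφ : ∀ t, ∀ x : Ω → Fin k → Fin n → ℝ, MemLp x 2 prob → MemLp (fun ω => φ t (x ω)) 2 prob) :
    Admissible prob D w (closedLoopControl D w φ) := fun t ht i => by
  have hu := (memLp_closedLoopControl hw hφ ht).eval i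
  refine ⟨(measurable_pi_apply i).comp ((hφm t).comp ?_), integrable_dotProduct hu hu⟩
  rw [← state_closedLoopControl]
  exact measurable_state_histSigma le_rfl

end ClosedLoop

section IdenticallyDistributed

variable {n : ℕ} {Ω Ω' : Type*} [MeasurableSpace Ω] [MeasurableSpace Ω'] {prob : Measure Ω}
  {prob' : Measure Ω'} {ξ : Ω → Fin n → ℝ} {η : Ω' → Fin n → ℝ}

theorem noiseMean_eq_of_identDistrib (h : IdentDistrib ξ η prob prob') :
    noiseMean prob ξ = noiseMean prob' η :=
  funext fun a => (h.comp (measurable_pi_apply a)).integral_eq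

theorem noiseCov_eq_of_identDistrib (h : IdentDistrib ξ η prob prob') :
    noiseCov prob ξ = noiseCov prob' η := by
  ext a b
  simp only [noiseCov, Matrix.of_apply, noiseMean_eq_of_identDistrib h]
  exact (h.comp (u := fun v => (v - noiseMean prob' η) a * (v - noiseMean prob' η) b)
    (by simp only [Pi.sub_apply]; fun_prop)).integral_eq

theorem noiseSkew_eq_of_identDistrib (h : IdentDistrib ξ η prob prob')
    (Q : Matrix (Fin n) (Fin n) ℝ) : noiseSkew prob ξ Q = noiseSkew prob' η Q := by
  ext a
  simp only [noiseSkew, noiseMean_eq_of_identDistrib h]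
  exact (h.comp (u := fun v => (v - noiseMean prob' η) a * quad Q (v - noiseMean prob' η))
    (by simp only [Pi.sub_apply]; fun_prop)).integral_eq

end IdenticallyDistributed

section DisturbanceMoments

variable {k n m : ℕ} {Ω : Type*} [MeasurableSpace Ω] {prob : Measure Ω} {T t : ℕ}
  {ξ : Ω → Fin n → ℝ} {w : ℕ → Ω → Fin k → Fin n → ℝ}

/-- The disturbances `w₁, …, w_T` are independent over time, have finite fourth moments, and the
disturbance of each subsystem has at all times the mean, the covariance matrix and the skew vectors
of `ξ`. Neither its law nor the joint law of the subsystems is constrained further. -/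
structure HasMomentsOf (prob : Measure Ω) (T : ℕ) (ξ : Ω → Fin n → ℝ)
    (w : ℕ → Ω → Fin k → Fin n → ℝ) : Prop where
  measurable : ∀ t < T, Measurable (w (t + 1))
  indep_time : iIndepFun (fun t : Fin T => w (t + 1)) prob
  memLp_four : ∀ t < T, MemLp (w (t + 1)) 4 prob
  noiseMean_eq : ∀ t < T, ∀ i, noiseMean prob (fun ω => w (t + 1) ω i) = noiseMean prob ξ
  noiseCov_eq : ∀ t < T, ∀ i, noiseCov prob (fun ω => w (t + 1) ω i) = noiseCov prob ξ
  noiseSkew_eq : ∀ t < T, ∀ i Q,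
    noiseSkew prob (fun ω => w (t + 1) ω i) Q = noiseSkew prob ξ Q

theorem HasMomentsOf.memLp_two [IsFiniteMeasure prob] (hw : HasMomentsOf prob T ξ w) (ht : t < T) :
    MemLp (w (t + 1)) 2 prob :=
  memLp_two_of_memLp_four (hw.memLp_four t ht)

theorem DisturbanceAssumption.memLp_four (hw : DisturbanceAssumption prob T w) (ht : t < T) :
    MemLp (w (t + 1)) 4 prob := by
  refine .of_eval fun i => ?_
  have hmeas : Measurable fun ω => w (t + 1) ω i :=
    (measurable_pi_apply i).comp (hw.measurable t ht)
  exact_mod_cast memLp_of_integrable_dotProduct_self_pow two_ne_zero hmeas.aestronglyMeasurable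
    (hw.fourth_moment t ht i)

theorem DisturbanceAssumption.hasMomentsOf [NeZero k] (hw : DisturbanceAssumption prob T w)
    (hT : 0 < T) : HasMomentsOf prob T (fun ω => w 1 ω 0) w := by
  have hident (t : ℕ) (ht : t < T) (i : Fin k) :
      IdentDistrib (fun ω => w (t + 1) ω i) (fun ω => w 1 ω 0) prob prob :=
    (hw.ident_sub t ht i 0).trans ((hw.ident_time t ht 0 hT).comp (measurable_pi_apply 0))
  exact
    { measurable := hw.measurable
      indep_time := hw.indep_time
      memLp_four := fun t ht => hw.memLp_four ht
      noiseMean_eq := fun t ht i => noiseMean_eq_of_identDistrib (hident t ht i)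
      noiseCov_eq := fun t ht i => noiseCov_eq_of_identDistrib (hident t ht i)
      noiseSkew_eq := fun t ht i => noiseSkew_eq_of_identDistrib (hident t ht i) }

end DisturbanceMoments

section ExpectedCost

variable {k n m : ℕ} {Ω : Type*} [MeasurableSpace Ω] {prob : Measure Ω} {D : Data k n m}
  {ξ : Ω → Fin n → ℝ} {w : ℕ → Ω → Fin k → Fin n → ℝ} {u : ℕ → Ω → Fin k → Fin m → ℝ} {t : ℕ}

namespace HasMomentsOf

theorem memLp_control (hw : HasMomentsOf prob D.T ξ w) (hu : Admissible prob D w u)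
    (ht : t < D.T) : MemLp (u t) 2 prob :=
  hu.memLp_control hw.measurable ht

theorem memLp_state [IsFiniteMeasure prob] (hw : HasMomentsOf prob D.T ξ w)
    (hu : Admissible prob D w u) (ht : t ≤ D.T) : MemLp (state D w u t) 2 prob :=
  MeanFieldLQ.memLp_state (fun _ hs => hw.memLp_two (hs.trans_le ht))
    fun _ hs => hw.memLp_control hu (hs.trans_le ht)

theorem memLp_drift [IsFiniteMeasure prob] (hw : HasMomentsOf prob D.T ξ w)
    (hu : Admissible prob D w u) (ht : t < D.T) :
    MemLp (fun ω => drift D t (state D w u t ω) (u t ω)) 2 prob :=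
  MeanFieldLQ.memLp_drift D t (hw.memLp_state hu ht.le) (hw.memLp_control hu ht)

theorem indep_noise_histSigma (hw : HasMomentsOf prob D.T ξ w) (hu : Admissible prob D w u)
    (ht : t < D.T) :
    Indep (MeasurableSpace.comap (w (t + 1)) inferInstance) (histSigma D w u t) prob :=
  hu.indep_noise_histSigma hw.measurable hw.indep_time ht

theorem indep_subsystem_noise_histSigma (hw : HasMomentsOf prob D.T ξ w)
    (hu : Admissible prob D w u) (ht : t < D.T) (i : Fin k) :
    Indep (MeasurableSpace.comap (fun ω => w (t + 1) ω i) inferInstance) (histSigma D w u t) prob :=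
  indep_of_indep_of_le_left (hw.indep_noise_histSigma hu ht)
    (Measurable.comap_le ((measurable_pi_apply i).comp (comap_measurable (w (t + 1)))))

theorem indepFun_drift_noise (hw : HasMomentsOf prob D.T ξ w) (hu : Admissible prob D w u)
    (ht : t < D.T) :
    IndepFun (fun ω => drift D t (state D w u t ω) (u t ω)) (w (t + 1)) prob :=
  (indep_of_indep_of_le_right (hw.indep_noise_histSigma hu ht)
    (hu.measurable_drift ht).comap_le).symm

end HasMomentsOf

theorem predError_zero (prob : Measure Ω) [IsProbabilityMeasure prob] (D : Data k n m)
    (w : ℕ → Ω → Fin k → Fin n → ℝ) (u : ℕ → Ω → Fin k → Fin m → ℝ) (i : Fin k) (ω : Ω) :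
    predError prob D w u 0 i ω = 0 := by
  simp only [predError, prevSigma, state, condExp_const bot_le, sub_self]

variable [IsProbabilityMeasure prob]

theorem memLp_predError_succ (hw : HasMomentsOf prob D.T ξ w) (hQ : (D.Q (t + 1)).IsSymm)
    (hu : Admissible prob D w u) (ht : t < D.T) (i : Fin k) :
    MemLp (predError prob D w u (t + 1) i) 2 prob :=
  memLp_quad_add_sub_condExp (hu.histSigma_le hw.measurable ht.le) hQ
    ((measurable_pi_apply i).comp (hw.measurable t ht))
    (hw.indep_subsystem_noise_histSigma hu ht i)
    ((measurable_pi_apply i).comp (hu.measurable_drift ht)) ((hw.memLp_drift hu ht).eval i)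
    ((hw.memLp_four t ht).eval i)

theorem exists_integral_sq_predError_succ (hw : HasMomentsOf prob D.T ξ w)
    (hQ : (D.Q (t + 1)).IsSymm) (ht : t < D.T) (i : Fin k) :
    ∃ c, ∀ u : ℕ → Ω → Fin k → Fin m → ℝ, Admissible prob D w u →
      ∫ ω, predError prob D w u (t + 1) i ω ^ 2 ∂prob
        = 4 * ∫ ω, quad (D.Q (t + 1) * noiseCov prob ξ * D.Q (t + 1))
              (state D w u (t + 1) ω i) ∂prob
          + 4 * ∫ ω, (D.Q (t + 1) *ᵥ noiseSkew prob ξ (D.Q (t + 1)))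
              ⬝ᵥ state D w u (t + 1) ω i ∂prob + c := by
  refine ⟨∫ ω, centeredEnergy prob (fun ω => w (t + 1) ω i) (D.Q (t + 1)) ω ^ 2 ∂prob
    - 4 * ∫ ω, quad (D.Q (t + 1) * noiseCov prob (fun ω => w (t + 1) ω i) * D.Q (t + 1))
      (w (t + 1) ω i - noiseMean prob fun ω => w (t + 1) ω i) ∂prob, fun u hu => ?_⟩
  rw [← hw.noiseCov_eq t ht i, ← hw.noiseSkew_eq t ht i]
  exact integral_sq_quad_add_sub_condExp (hu.histSigma_le hw.measurable ht.le) hQ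
    ((measurable_pi_apply i).comp (hw.measurable t ht))
    (hw.indep_subsystem_noise_histSigma hu ht i)
    ((measurable_pi_apply i).comp (hu.measurable_drift ht)) ((hw.memLp_drift hu ht).eval i)
    ((hw.memLp_four t ht).eval i)

theorem integrable_riskCost (hw : HasMomentsOf prob D.T ξ w) (hQ : ∀ t ≤ D.T, (D.Q t).IsSymm)
    (hu : Admissible prob D w u) (ht : t ≤ D.T) : Integrable (riskCost prob D w u t) prob := by
  refine (integrable_finsetSum _ fun i _ => ?_).const_mul _
  cases t with
  | zero => simp only [predError_zero]; exact integrable_const _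
  | succ t => exact (memLp_predError_succ hw (hQ _ ht) hu ht i).integrable_sq

theorem exists_integral_riskCost (hw : HasMomentsOf prob D.T ξ w)
    (hQ : ∀ t ≤ D.T, (D.Q t).IsSymm) (ht : t ≤ D.T) :
    ∃ c, ∀ u : ℕ → Ω → Fin k → Fin m → ℝ, Admissible prob D w u →
      ∫ ω, riskCost prob D w u t ω ∂prob
        = ∫ ω, riskAdjustment prob D ξ t (state D w u t ω) ∂prob + c := by
  cases t with
  | zero =>
    refine ⟨-riskAdjustment prob D ξ 0 D.x0, fun u _ => ?_⟩
    simp [riskCost, predError_zero, state]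
  | succ t =>
    choose c hc using fun i => exists_integral_sq_predError_succ hw (hQ _ ht) ht i
    refine ⟨D.lam * ∑ i, c i, fun u hu => ?_⟩
    simp only [riskCost]
    rw [integral_const_mul,
      integral_finsetSum _ fun i _ => (memLp_predError_succ hw (hQ _ ht) hu ht i).integrable_sq,
      integral_riskAdjustment D ξ (t + 1) (hw.memLp_state hu ht), ← mul_add,
      ← Finset.sum_add_distrib]
    exact congrArg _ (Finset.sum_congr rfl fun i _ => hc i u hu)

theorem integrable_totalCost (hw : HasMomentsOf prob D.T ξ w) (hQ : ∀ t ≤ D.T, (D.Q t).IsSymm)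
    (hu : Admissible prob D w u) : Integrable (totalCost prob D w u) prob := by
  have hstate {t : ℕ} (ht : t ≤ D.T) :
      Integrable (fun ω => stateCost D t (state D w u t ω) + riskCost prob D w u t ω) prob :=
    (integrable_stateCost D t (hw.memLp_state hu ht)).add (integrable_riskCost hw hQ hu ht)
  refine (hstate le_rfl).add (integrable_finsetSum _ fun t ht => ?_)
  have ht := Finset.mem_range.1 ht
  exact (hstate ht.le).add (integrable_controlCost D t (hw.memLp_control hu ht))

variable [NeZero k]

theorem exists_integral_stage_add_value (h : RiccatiRegular prob D ξ)
    (hw : HasMomentsOf prob D.T ξ w) (ht : t < D.T) :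
    ∃ c, ∀ u : ℕ → Ω → Fin k → Fin m → ℝ, Admissible prob D w u →
      ∫ ω, (stateCost D t (state D w u t ω) + riskCost prob D w u t ω
          + controlCost D t (u t ω)) ∂prob
        + ∫ ω, value prob D ξ (t + 1) (state D w u (t + 1) ω) ∂prob
        = ∫ ω, value prob D ξ t (state D w u t ω) ∂prob
          + ∫ ω, gap prob D ξ t (state D w u t ω) (u t ω) ∂prob + c := by
  obtain ⟨cost, hcost⟩ := exists_integral_riskCost hw h.isSymm_Q ht.le
  obtain ⟨c, hc⟩ := exists_integral_dynamic_programming h ht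
  refine ⟨cost + c + (∑ i, ∫ ω, quad (S prob D ξ (t + 1))
      (w (t + 1) ω i - meanField (w (t + 1) ω)) ∂prob + k * ∫ ω, quad (Sbar prob D ξ (t + 1))
      (meanField (w (t + 1) ω) - noiseMean prob ξ) ∂prob), fun u hu => ?_⟩
  have hx := hw.memLp_state hu ht.le
  have hv := hw.memLp_control hu ht
  have hstate := integrable_stateCost D t hx
  have hrisk := integrable_riskCost hw h.isSymm_Q hu ht.le
  have hnext : ∫ ω, value prob D ξ (t + 1) (state D w u (t + 1) ω) ∂prob = _ :=
    integral_value_add (t := t + 1) h ht (hw.indepFun_drift_noise hu ht) (hw.memLp_drift hu ht)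
      (hw.memLp_two ht) (hw.noiseMean_eq t ht)
  rw [integral_add (hstate.fun_add hrisk) (integrable_controlCost D t hv),
    integral_add hstate hrisk, hnext, hcost u hu]
  linarith [hc _ _ hx hv]

theorem exists_integral_totalCost (h : RiccatiRegular prob D ξ) (hw : HasMomentsOf prob D.T ξ w) :
    ∃ c, ∀ u : ℕ → Ω → Fin k → Fin m → ℝ, Admissible prob D w u →
      ∫ ω, totalCost prob D w u ω ∂prob
        = ∑ t ∈ Finset.range D.T, ∫ ω, gap prob D ξ t (state D w u t ω) (u t ω) ∂prob + c := by
  choose! c hc using fun t (ht : t < D.T) => exists_integral_stage_add_value h hw ht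
  obtain ⟨cT, hcT⟩ := exists_integral_riskCost hw h.isSymm_Q le_rfl
  refine ⟨∫ _, value prob D ξ 0 D.x0 ∂prob + ∑ t ∈ Finset.range D.T, c t + cT, fun u hu => ?_⟩
  have hstate {t : ℕ} (ht : t ≤ D.T) := integrable_stateCost D t (hw.memLp_state hu ht)
  have hrisk {t : ℕ} (ht : t ≤ D.T) := integrable_riskCost hw h.isSymm_Q hu ht
  have hstage (t : ℕ) (ht : t ∈ Finset.range D.T) :=
    ((hstate (Finset.mem_range.1 ht).le).fun_add (hrisk (Finset.mem_range.1 ht).le)).fun_add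
      (integrable_controlCost D t (hw.memLp_control hu (Finset.mem_range.1 ht)))
  have hterminal : ∫ ω, value prob D ξ D.T (state D w u D.T ω) ∂prob
      = ∫ ω, stateCost D D.T (state D w u D.T ω) ∂prob
        + ∫ ω, riskAdjustment prob D ξ D.T (state D w u D.T ω) ∂prob := by
    simp only [value_terminal h]
    exact integral_add (hstate le_rfl)
      (integrable_riskAdjustment D ξ D.T (hw.memLp_state hu le_rfl))
  have htelescope := Finset.sum_range_sub'
    (fun t => ∫ ω, value prob D ξ t (state D w u t ω) ∂prob) D.T
  have hsum := Finset.sum_congr rfl fun t ht =>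
    eq_sub_of_add_eq (hc t (Finset.mem_range.1 ht) u hu)
  simp only [add_sub_right_comm, add_right_comm _ _ (c _), Finset.sum_add_distrib, htelescope]
    at hsum
  simp only [totalCost]
  rw [integral_add ((hstate le_rfl).fun_add (hrisk le_rfl)) (integrable_finsetSum _ hstage),
    integral_add (hstate le_rfl) (hrisk le_rfl), integral_finsetSum _ hstage, hsum, hcT u hu,
    hterminal, state]
  ring

end ExpectedCost

section Optimality

variable {k n m : ℕ} {Ω : Type*} [MeasurableSpace Ω] {prob : Measure Ω} {D : Data k n m}
  {ξ : Ω → Fin n → ℝ} {w : ℕ → Ω → Fin k → Fin n → ℝ} {u : ℕ → Ω → Fin k → Fin m → ℝ}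

theorem measurable_feedback (prob : Measure Ω) (D : Data k n m) (ξ : Ω → Fin n → ℝ) (t : ℕ) :
    Measurable (feedback prob D ξ t) :=
  measurable_pi_lambda _ fun i =>
    (((measurable_mulVec _).comp (measurable_pi_apply i)).add
      ((measurable_mulVec _).comp measurable_meanField)).add_const _

theorem memLp_feedback [IsFiniteMeasure prob] {p : ENNReal} {x : Ω → Fin k → Fin n → ℝ}
    (D : Data k n m) (ξ : Ω → Fin n → ℝ) (t : ℕ) (hx : MemLp x p prob) :
    MemLp (fun ω => feedback prob D ξ t (x ω)) p prob :=
  .of_eval fun i => ((memLp_mulVec _ (hx.eval i)).add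
    (memLp_mulVec _ (memLp_meanField hx))).add (memLp_const _)

variable [IsProbabilityMeasure prob]

theorem admissible_closedLoopControl_feedback (hw : HasMomentsOf prob D.T ξ w) :
    Admissible prob D w (closedLoopControl D w (feedback prob D ξ)) :=
  admissible_closedLoopControl (fun _ ht => hw.memLp_two ht) (measurable_feedback prob D ξ)
    fun t _ hx => memLp_feedback D ξ t hx

variable [NeZero k]

theorem gap_closedLoopControl_feedback (prob : Measure Ω) (D : Data k n m) (ξ : Ω → Fin n → ℝ)
    (w : ℕ → Ω → Fin k → Fin n → ℝ) (t : ℕ) (ω : Ω) :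
    gap prob D ξ t (state D w (closedLoopControl D w (feedback prob D ξ)) t ω)
      (closedLoopControl D w (feedback prob D ξ) t ω) = 0 := by
  rw [state_closedLoopControl, closedLoopControl, gap_feedback]

theorem integral_totalCost_eq_closedLoop_add (h : RiccatiRegular prob D ξ)
    (hw : HasMomentsOf prob D.T ξ w) (hu : Admissible prob D w u) :
    ∫ ω, totalCost prob D w u ω ∂prob
      = ∫ ω, totalCost prob D w (closedLoopControl D w (feedback prob D ξ)) ω ∂prob
        + ∑ t ∈ Finset.range D.T, ∫ ω, gap prob D ξ t (state D w u t ω) (u t ω) ∂prob := by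
  obtain ⟨c, hc⟩ := exists_integral_totalCost h hw
  rw [hc u hu, hc _ (admissible_closedLoopControl_feedback hw)]
  simp only [gap_closedLoopControl_feedback, integral_zero, Finset.sum_const_zero, zero_add]
  exact add_comm _ _

theorem isOptimal_closedLoopControl_feedback (h : RiccatiRegular prob D ξ)
    (hw : HasMomentsOf prob D.T ξ w) :
    IsOptimal prob D w (closedLoopControl D w (feedback prob D ξ)) := by
  refine ⟨admissible_closedLoopControl_feedback hw, fun v hv => ?_⟩
  rw [integral_totalCost_eq_closedLoop_add h hw hv]
  exact le_add_of_nonneg_right (Finset.sum_nonneg fun t ht =>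
    integral_nonneg fun _ => gap_nonneg h (Finset.mem_range.1 ht) _ _)

theorem IsOptimal.ae_eq_closedLoopControl_feedback (hu : IsOptimal prob D w u)
    (h : RiccatiRegular prob D ξ) (hw : HasMomentsOf prob D.T ξ w) {t : ℕ} (ht : t < D.T) :
    ∀ᵐ ω ∂prob, u t ω = closedLoopControl D w (feedback prob D ξ) t ω := by
  have hnonneg {s : ℕ} (hs : s < D.T) (ω : Ω) : 0 ≤ gap prob D ξ s (state D w u s ω) (u s ω) :=
    gap_nonneg h hs _ _
  have hintegral_nonneg : ∀ s ∈ Finset.range D.T,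
      0 ≤ ∫ ω, gap prob D ξ s (state D w u s ω) (u s ω) ∂prob :=
    fun s hs => integral_nonneg (hnonneg (Finset.mem_range.1 hs))
  have hexcess : ∑ s ∈ Finset.range D.T,
      ∫ ω, gap prob D ξ s (state D w u s ω) (u s ω) ∂prob = 0 := by
    refine le_antisymm ?_ (Finset.sum_nonneg hintegral_nonneg)
    have hle := hu.2 _ (admissible_closedLoopControl_feedback hw)
    rwa [integral_totalCost_eq_closedLoop_add h hw hu.1, add_le_iff_nonpos_right] at hle
  refine ae_eq_closedLoopControl (fun s hs => ?_) ht
  have hgap := (integral_eq_zero_iff_of_nonneg (hnonneg hs) (integrable_gap D ξ s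
    (hw.memLp_state hu.1 hs.le) (hw.memLp_control hu.1 hs))).1
    ((Finset.sum_eq_zero_iff_of_nonneg hintegral_nonneg).1 hexcess s (Finset.mem_range.2 hs))
  filter_upwards [hgap] with ω hω using eq_feedback_of_gap_eq_zero h hs hω

end Optimality

end MeanFieldLQ

theorem theorem2_general {k n m : ℕ} [NeZero k] {Ω : Type*} [MeasurableSpace Ω]
    (prob : Measure Ω) [IsProbabilityMeasure prob] (D : MeanFieldLQ.Data k n m)
    (ξ : Ω → Fin n → ℝ) (h : MeanFieldLQ.RiccatiRegular prob D ξ)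
    (w : ℕ → Ω → Fin k → Fin n → ℝ) (hw : MeanFieldLQ.HasMomentsOf prob D.T ξ w) :
    (∀ u : ℕ → Ω → Fin k → Fin m → ℝ, MeanFieldLQ.Admissible prob D w u →
      Integrable (MeanFieldLQ.totalCost prob D w u) prob) ∧
    ∃ u : ℕ → Ω → Fin k → Fin m → ℝ,
      (∀ t < D.T, ∀ (i : Fin k) (ω : Ω),
        u t ω i =
          MeanFieldLQ.K prob D ξ t *ᵥ MeanFieldLQ.state D w u t ω i
          + (MeanFieldLQ.Kbar prob D ξ t - MeanFieldLQ.K prob D ξ t) *ᵥ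
              MeanFieldLQ.meanField (MeanFieldLQ.state D w u t ω)
          + MeanFieldLQ.f prob D ξ t) ∧
      MeanFieldLQ.IsOptimal prob D w u ∧
      ∀ v : ℕ → Ω → Fin k → Fin m → ℝ, MeanFieldLQ.IsOptimal prob D w v →
        ∀ t < D.T, ∀ i : Fin k, (fun ω => v t ω i) =ᵐ[prob] (fun ω => u t ω i) := by
  refine ⟨fun u hu => MeanFieldLQ.integrable_totalCost hw h.isSymm_Q hu,
    MeanFieldLQ.closedLoopControl D w (MeanFieldLQ.feedback prob D ξ), fun t _ i ω => ?_,
    MeanFieldLQ.isOptimal_closedLoopControl_feedback h hw, fun v hv t ht i => ?_⟩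
  · rw [MeanFieldLQ.state_closedLoopControl, MeanFieldLQ.closedLoopControl, MeanFieldLQ.feedback]
  · filter_upwards [hv.ae_eq_closedLoopControl_feedback h hw ht] with ω hω
    rw [hω]

/-- The common law of the disturbances enters through `w 1 · 0`, the disturbance of the first
subsystem at time `1`. -/
theorem theorem2 {k n m : ℕ} [NeZero k] {Ω : Type*} [MeasurableSpace Ω]
    (prob : Measure Ω) [IsProbabilityMeasure prob]
    (D : MeanFieldLQ.Data k n m) (hT : 0 < D.T) (hlam : 0 ≤ D.lam)
    (hP : ∀ t ≤ D.T, (D.P t).PosSemidef)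
    (hQ : ∀ t ≤ D.T, (D.Q t).PosSemidef)
    (hR : ∀ t < D.T, (D.R t).PosDef)
    (w : ℕ → Ω → Fin k → Fin n → ℝ)
    (hw : MeanFieldLQ.DisturbanceAssumption prob D.T w) :
    -- the expected cost of every admissible control is finite
    (∀ u : ℕ → Ω → Fin k → Fin m → ℝ, MeanFieldLQ.Admissible prob D w u →
      Integrable (MeanFieldLQ.totalCost prob D w u) prob) ∧
    -- the matrices inverted in the recursions are invertible
    (∀ t < D.T,
      IsUnit (MeanFieldLQ.pivot (D.B t) (D.R t)
        (MeanFieldLQ.S prob D (fun ω => w 1 ω 0) (t + 1))) ∧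
      IsUnit (MeanFieldLQ.pivot (D.B t) (D.R t)
        (MeanFieldLQ.Sbar prob D (fun ω => w 1 ω 0) (t + 1)))) ∧
    -- the mean-field feedback control is optimal, and it is the only optimal control
    ∃ u : ℕ → Ω → Fin k → Fin m → ℝ,
      (∀ t < D.T, ∀ (i : Fin k) (ω : Ω),
        u t ω i =
          MeanFieldLQ.K prob D (fun ω' => w 1 ω' 0) t *ᵥ MeanFieldLQ.state D w u t ω i
          + (MeanFieldLQ.Kbar prob D (fun ω' => w 1 ω' 0) t
              - MeanFieldLQ.K prob D (fun ω' => w 1 ω' 0) t) *ᵥ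
              MeanFieldLQ.meanField (MeanFieldLQ.state D w u t ω)
          + MeanFieldLQ.f prob D (fun ω' => w 1 ω' 0) t) ∧
      MeanFieldLQ.IsOptimal prob D w u ∧
      ∀ v : ℕ → Ω → Fin k → Fin m → ℝ, MeanFieldLQ.IsOptimal prob D w v →
        ∀ t < D.T, ∀ i : Fin k, (fun ω => v t ω i) =ᵐ[prob] (fun ω => u t ω i) := by
  have hmoments := hw.hasMomentsOf hT
  have hreg := MeanFieldLQ.riccatiRegular_of_posSemidef hP hQ hR fun t ht =>
    MeanFieldLQ.posSemidef_Qlam hlam (Matrix.isHermitian_iff_isSymm.1 (hQ t ht).isHermitian)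
      ((hmoments.memLp_two hT).eval 0)
  obtain ⟨hintegrable, hoptimal⟩ := theorem2_general prob D _ hreg w hmoments
  exact ⟨hintegrable, fun t ht =>
    ⟨(hreg.posDef_pivot_S t ht).isUnit, (hreg.posDef_pivot_Sbar t ht).isUnit⟩, hoptimal⟩
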